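/- All manifolds are smooth ($C^\infty$), Hausdorff and second countable, not necessarily connected, and all maps are smooth. Let $M^n$ be an $n$-dimensional Riemannian manifold with positive Ricci curvature, that is, $\mathrm{Ric}(X,X)>0$ for every nonzero tangent vector $X$, and let $f\colon M^n\to\mathbb{R}^{n+p}$ be an isometric immersion. Then, for every integer $q\ge 0$ with $q<n-p$, $f$ is \emph{singularly genuinely rigid} in $\mathbb{R}^{n+q}$: for every isometric immersion $\hat f\colon M^n\to\mathbb{R}^{n+q}$ there is an open dense subset $U\subset M^n$ such that $f|_U$ and $\hat f|_U$ singularly extend isometrically. Here $f|_U$ and $\hat f|_U$ \emph{singularly extend isometrically} if there are a manifold $N^{n+s}$ of dimension $n+s$ with $s>0$, an embedding $j\colon U\hookrightarrow N^{n+s}$, and maps $F\colon N^{n+s}\to\mathbb{R}^{n+p}$ and $\hat F\colon N^{n+s}\to\mathbb{R}^{n+q}$ that induce the same (possibly degenerate) metric on $N^{n+s}$, i.e. $\langle dF(v),dF(w)\rangle=\langle d\hat F(v),d\hat F(w)\rangle$ for all $v,w\in T_xN$ and $x\in N$, such that $f|_U=F\circ j$, $\hat f|_U=\hat F\circ j$,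 and every point of $N^{n+s}$ at which $dF$ or $d\hat F$ is not injective lies in $j(U)$. -/

import Mathlib

open scoped Manifold ContDiff

/-- Partial derivative of a real function of `n` real variables in the `i`-th direction. -/
noncomputable def partialDeriv {n : ℕ} (i : Fin n) (h : EuclideanSpace ℝ (Fin n) → ℝ)
    (y : EuclideanSpace ℝ (Fin n)) : ℝ :=
  fderiv ℝ h y (EuclideanSpace.single i 1)

/-- Christoffel symbol `Γᵏᵢⱼ = ½ ∑ₗ gᵏˡ (∂ᵢ gⱼₗ + ∂ⱼ gᵢₗ - ∂ₗ gᵢⱼ)` of a metric with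
coefficient matrix `G`. -/
noncomputable def christoffel {n : ℕ}
    (G : EuclideanSpace ℝ (Fin n) → Matrix (Fin n) (Fin n) ℝ) (k i j : Fin n)
    (y : EuclideanSpace ℝ (Fin n)) : ℝ :=
  (1 / 2 : ℝ) * ∑ l, (G y)⁻¹ k l *
    (partialDeriv i (fun z => G z j l) y + partialDeriv j (fun z => G z i l) y
      - partialDeriv l (fun z => G z i j) y)

/-- Coefficient `Rˡᵢⱼₖ` of `R(∂ᵢ, ∂ⱼ) ∂ₖ = ∑ₗ Rˡᵢⱼₖ ∂ₗ`, where
`R(X, Y) Z = ∇_X ∇_Y Z - ∇_Y ∇_X Z - ∇_[X, Y] Z`. -/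
noncomputable def curvatureCoeff {n : ℕ}
    (G : EuclideanSpace ℝ (Fin n) → Matrix (Fin n) (Fin n) ℝ) (l i j k : Fin n)
    (y : EuclideanSpace ℝ (Fin n)) : ℝ :=
  partialDeriv i (christoffel G l j k) y - partialDeriv j (christoffel G l i k) y
    + ∑ m, (christoffel G m j k y * christoffel G l i m y
      - christoffel G m i k y * christoffel G l j m y)

/-- Ricci coefficient `Ricⱼₖ = ∑ᵢ Rⁱᵢⱼₖ`, the trace of `X ↦ R(X, ∂ⱼ) ∂ₖ`. -/
noncomputable def ricciCoeff {n : ℕ}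
    (G : EuclideanSpace ℝ (Fin n) → Matrix (Fin n) (Fin n) ℝ) (j k : Fin n)
    (y : EuclideanSpace ℝ (Fin n)) : ℝ :=
  ∑ i, curvatureCoeff G i i j k y

/-- A smooth Riemannian metric on a smooth `n`-manifold. -/
abbrev SmoothMetric (n : ℕ) (M : Type*) [TopologicalSpace M]
    [ChartedSpace (EuclideanSpace ℝ (Fin n)) M] [IsManifold (𝓡 n) ∞ M] :=
  Bundle.ContMDiffRiemannianMetric (𝓡 n) ∞ (EuclideanSpace ℝ (Fin n))
    (fun x : M => TangentSpace (𝓡 n) x)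

section Metric

variable {n : ℕ} {M : Type*} [TopologicalSpace M]
  [ChartedSpace (EuclideanSpace ℝ (Fin n)) M] [IsManifold (𝓡 n) ∞ M]

/-- The coefficients `gᵢⱼ = g(∂ᵢ, ∂ⱼ)` of the metric in the preferred chart at `x`. -/
noncomputable def metricCoeff (g : SmoothMetric n M) (x : M)
    (y : EuclideanSpace ℝ (Fin n)) : Matrix (Fin n) (Fin n) ℝ :=
  Matrix.of fun i j =>
    g.inner ((extChartAt (𝓡 n) x).symm y)
      (mfderiv 𝓘(ℝ, EuclideanSpace ℝ (Fin n)) (𝓡 n) (extChartAt (𝓡 n) x).symm y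
        (EuclideanSpace.single i (1 : ℝ)))
      (mfderiv 𝓘(ℝ, EuclideanSpace ℝ (Fin n)) (𝓡 n) (extChartAt (𝓡 n) x).symm y
        (EuclideanSpace.single j (1 : ℝ)))

/-- The components of a tangent vector at `x` in the preferred chart at `x`. -/
noncomputable def tangentCoords (x : M) (v : TangentSpace (𝓡 n) x) :
    EuclideanSpace ℝ (Fin n) :=
  mfderiv (𝓡 n) 𝓘(ℝ, EuclideanSpace ℝ (Fin n)) (extChartAt (𝓡 n) x) x v

/-- The Ricci tensor `Ric_x(v, w) = ∑ⱼₖ Ricⱼₖ vʲ wᵏ`. -/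
noncomputable def ricciTensor (g : SmoothMetric n M) (x : M)
    (v w : TangentSpace (𝓡 n) x) : ℝ :=
  ∑ j, ∑ k, ricciCoeff (metricCoeff g x) j k (extChartAt (𝓡 n) x x)
    * tangentCoords x v j * tangentCoords x w k

def HasPositiveRicci (g : SmoothMetric n M) : Prop :=
  ∀ (x : M) (v : TangentSpace (𝓡 n) x), v ≠ 0 → 0 < ricciTensor g x v v

end Metric

/-- The (possibly degenerate) symmetric form `⟨dF_x v, dF_x w⟩` that a map into Euclidean space
induces on the tangent space at `x`. -/
noncomputable def inducedForm (E : Type*) [NormedAddCommGroup E] [NormedSpace ℝ E]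
    {N : Type*} [TopologicalSpace N] [ChartedSpace E N] {m : ℕ}
    (F : N → EuclideanSpace ℝ (Fin m)) (x : N) (v w : TangentSpace 𝓘(ℝ, E) x) : ℝ :=
  @inner ℝ (EuclideanSpace ℝ (Fin m)) _
    (mfderiv 𝓘(ℝ, E) 𝓘(ℝ, EuclideanSpace ℝ (Fin m)) F x v)
    (mfderiv 𝓘(ℝ, E) 𝓘(ℝ, EuclideanSpace ℝ (Fin m)) F x w)

/-- Smooth isometric immersions `f : (M, g) → ℝᵐ`. Injectivity of the differential follows from
positive definiteness of `g`. -/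
structure IsIsometricImmersion {n : ℕ} {M : Type*} [TopologicalSpace M]
    [ChartedSpace (EuclideanSpace ℝ (Fin n)) M] [IsManifold (𝓡 n) ∞ M]
    (g : SmoothMetric n M) {m : ℕ} (f : M → EuclideanSpace ℝ (Fin m)) : Prop where
  smooth : ContMDiff (𝓡 n) 𝓘(ℝ, EuclideanSpace ℝ (Fin m)) ∞ f
  isometric : ∀ (x : M) (v w : TangentSpace (𝓡 n) x), inducedForm (EuclideanSpace ℝ (Fin n)) f x v w = g.inner x v w

/-- `F` is an immersion at `x`: its differential at `x` is injective. -/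
def ImmersiveAt (E : Type*) [NormedAddCommGroup E] [NormedSpace ℝ E]
    {N : Type*} [TopologicalSpace N] [ChartedSpace E N] {m : ℕ}
    (F : N → EuclideanSpace ℝ (Fin m)) (x : N) : Prop :=
  Function.Injective (mfderiv 𝓘(ℝ, E) 𝓘(ℝ, EuclideanSpace ℝ (Fin m)) F x)

/-- `j : M ↪ N` is an embedding and `F`, `F'` are smooth maps of `N` inducing the same (possibly
degenerate) metric on `N`, extending `f` and `f'` along `j`, and immersive off `j(M)`. -/
structure IsSingularIsometricExtension (n : ℕ) {a b : ℕ}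
    {M : Type*} [TopologicalSpace M] [ChartedSpace (EuclideanSpace ℝ (Fin n)) M]
    (E : Type*) [NormedAddCommGroup E] [NormedSpace ℝ E]
    {N : Type*} [TopologicalSpace N] [ChartedSpace E N]
    (f : M → EuclideanSpace ℝ (Fin a)) (f' : M → EuclideanSpace ℝ (Fin b))
    (j : M → N) (F : N → EuclideanSpace ℝ (Fin a)) (F' : N → EuclideanSpace ℝ (Fin b)) :
    Prop where
  embedding : Manifold.IsSmoothEmbedding (𝓡 n) 𝓘(ℝ, E) ∞ j
  smooth_left : ContMDiff 𝓘(ℝ, E) 𝓘(ℝ, EuclideanSpace ℝ (Fin a)) ∞ F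
  smooth_right : ContMDiff 𝓘(ℝ, E) 𝓘(ℝ, EuclideanSpace ℝ (Fin b)) ∞ F'
  isometric : ∀ (x : N) (v w : TangentSpace 𝓘(ℝ, E) x),
    inducedForm E F x v w = inducedForm E F' x v w
  extends_left : F ∘ j = f
  extends_right : F' ∘ j = f'
  singular_subset : {x : N | ¬ ImmersiveAt E F x ∨ ¬ ImmersiveAt E F' x} ⊆ Set.range j

/-- The pair `f`, `f'` of maps of an `n`-manifold singularly extends isometrically: a singular
isometric extension exists on some smooth manifold `N` of dimension `n + s`, `s > 0`. -/
def SingularlyExtendsIsometrically.{u} (n : ℕ) {a b : ℕ}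
    {M : Type u} [TopologicalSpace M] [ChartedSpace (EuclideanSpace ℝ (Fin n)) M]
    (f : M → EuclideanSpace ℝ (Fin a)) (f' : M → EuclideanSpace ℝ (Fin b)) : Prop :=
  ∃ (s : ℕ) (E : Type) (_ : NormedAddCommGroup E) (_ : NormedSpace ℝ E)
    (N : Type u) (_ : TopologicalSpace N) (_ : ChartedSpace E N)
    (j : M → N) (F : N → EuclideanSpace ℝ (Fin a)) (F' : N → EuclideanSpace ℝ (Fin b)),
    0 < s ∧ Module.finrank ℝ E = n + s ∧
    IsManifold 𝓘(ℝ, E) ∞ N ∧ T2Space N ∧ SecondCountableTopology N ∧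
    IsSingularIsometricExtension n E f f' j F F'

/-- `f : M → ℝ^a` is singularly genuinely rigid in `ℝ^(n+q)`. -/
def SingularlyGenuinelyRigid.{u} {n : ℕ} {M : Type u} [TopologicalSpace M]
    [ChartedSpace (EuclideanSpace ℝ (Fin n)) M] [IsManifold (𝓡 n) ∞ M]
    (g : SmoothMetric n M) {a : ℕ} (f : M → EuclideanSpace ℝ (Fin a)) (q : ℕ) : Prop :=
  ∀ f' : M → EuclideanSpace ℝ (Fin (n + q)), IsIsometricImmersion g f' →
    ∃ U : TopologicalSpace.Opens M, Dense (U : Set M) ∧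
      SingularlyExtendsIsometrically n (fun x : U => f (x : M)) (fun x : U => f' (x : M))

/-! Read in a chart, `f` and `f'` become maps `h` and `k` inducing the same metric. By the Gauss
equations the two second fundamental forms together form a flat bilinear form β with values in the
sum of the normal spaces, the second summand carrying the negative of its inner product. Choose Y
with β(Y, ·) of maximal rank. Its kernel has dimension at least n - p - q > 0
(`exists_ker_pairMap`), and for X in it flatness makes all β(Z, X) mutually orthogonal
(`inner_eq_of_mem_ker_of_maximal`). Where the rank is locally constant, X can be taken to be a
smooth field (`exists_isotropic_field`).

The ruled maps h + t h_*X and k + t k_*X then induce the same metric. Both are singular at t = 0,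
because the rulings are tangent, but for small t ≠ 0 they are immersions as soon as α(X, X) ≠ 0,
where α is the second fundamental form of h (`exists_local_ruled_extension`). This is where positive
Ricci curvature enters: the Gauss equation gives Ric(X, X) = ⟨tr α, α(X, X)⟩ - ∑ |α(eᵢ, X)|², which
is nonpositive if α(X, X) = 0 (`ricci_nonpos_of_asymptotic`).

Ruled extensions thus exist over a nonempty open part of every nonempty open set. A maximal disjoint
family of such parts has dense union U (`exists_isOpen_dense_of_local`), no compatibility between
parts being needed, and the extension lives on U × ℝ (`singularlyExtends_of_isRuledExtensionAt`). -/

open Topology Filter Module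

set_option linter.unusedSectionVars false

local notation "⟪" x ", " y "⟫" => inner ℝ x y
local notation "𝔼" m => EuclideanSpace ℝ (Fin m)

/-! ### Linear maps of maximal rank and their kernels -/

section MaximalRank

variable {P Q : Type*} [NormedAddCommGroup P] [NormedSpace ℝ P] [FiniteDimensional ℝ P]
  [NormedAddCommGroup Q] [NormedSpace ℝ Q] [FiniteDimensional ℝ Q]

/-- If `T` has maximal rank in the pencil `T + t • S`, then `S` maps `ker T` into `range T`. -/
theorem map_ker_subset_range_of_finrank_le (T S : P →L[ℝ] Q)
    (h : ∀ t : ℝ, finrank ℝ (LinearMap.range (T + t • S : P →L[ℝ] Q).toLinearMap) ≤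
      finrank ℝ (LinearMap.range T.toLinearMap))
    (k : P) (hk : T k = 0) : ∃ z, S k = T z := by
  by_contra hcon
  push Not at hcon
  set r := finrank ℝ (LinearMap.range T.toLinearMap) with hr
  let b := Module.finBasis ℝ (LinearMap.range T.toLinearMap)
  have hb : ∀ i, ∃ z, T z = b i := fun i => (b i).2
  choose z hz using hb
  have hli : LinearIndependent ℝ (fun i => T (z i)) := by
    have := b.linearIndependent.map' (Submodule.subtype _) (Submodule.ker_subtype _)
    simpa [Function.comp_def, hz] using this
  -- If `S k` is not in `range T`, these r + 1 vectors are independent at t = 0, hence for small t.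
  -- For t ≠ 0 they all lie in the range of `T + t • S`, since `k ∈ ker T` gives `(T + t • S) (t⁻¹ •
  -- k) = S k`; so the rank would exceed r.
  let w : ℝ → Option (Fin r) → Q := fun t o => o.elim (S k) (fun i => (T + t • S) (z i))
  have hw0 : LinearIndependent ℝ (w 0) := by
    rw [linearIndependent_option]
    constructor
    · simpa [w, Function.comp_def] using hli
    · intro hmem
      have hsub : Submodule.span ℝ (Set.range (w 0 ∘ ((↑) : Fin r → Option (Fin r)))) ≤
          LinearMap.range T.toLinearMap := by
        rw [Submodule.span_le]
        rintro _ ⟨i, rfl⟩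
        exact ⟨z i, by simp [w]⟩
      obtain ⟨y, hy⟩ := hsub hmem
      exact hcon y (by simpa [w] using hy.symm)
  have hcont : Continuous w := by
    refine continuous_pi fun o => ?_
    cases o with
    | none => exact continuous_const
    | some i => simp only [w, Option.elim]; fun_prop
  have hopen : ∀ᶠ t in 𝓝 (0 : ℝ), LinearIndependent ℝ (w t) :=
    hcont.continuousAt.eventually (isOpen_setOfPred_linearIndependent.mem_nhds hw0)
  obtain ⟨t, ht, ht0⟩ : ∃ t, LinearIndependent ℝ (w t) ∧ t ≠ 0 := by
    have h1 : ∀ᶠ t in 𝓝[≠] (0 : ℝ), LinearIndependent ℝ (w t) := hopen.filter_mono nhdsWithin_le_nhds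
    exact (h1.and self_mem_nhdsWithin).exists
  have hle : Submodule.span ℝ (Set.range (w t)) ≤
      LinearMap.range (T + t • S : P →L[ℝ] Q).toLinearMap := by
    rw [Submodule.span_le]
    rintro _ ⟨o, rfl⟩
    cases o with
    | none => exact ⟨t⁻¹ • k, by simp [w, hk, ht0]⟩
    | some i => exact ⟨z i, by simp [w]⟩
  have h1 := Submodule.finrank_mono hle
  rw [finrank_span_eq_card ht] at h1
  have h2 := h t
  have h3 := h1.trans h2
  simp only [Fintype.card_option, Fintype.card_fin] at h3
  exact absurd h3 (by omega)

/-- A kernel vector at a point of maximal rank extends to a smooth local section of the kernels. -/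
theorem exists_smooth_kernel_section {V : Type*} [NormedAddCommGroup V] [NormedSpace ℝ V]
    {Ω : Set V} (hΩ : IsOpen Ω) (L : V → P →L[ℝ] Q) (hL : ContDiffOn ℝ ∞ L Ω)
    {y₀ : V} (hy₀ : y₀ ∈ Ω)
    (hmax : ∀ y ∈ Ω, finrank ℝ (LinearMap.range (L y).toLinearMap) ≤
      finrank ℝ (LinearMap.range (L y₀).toLinearMap))
    (k : P) (hk : L y₀ k = 0) :
    ∃ Ω' ⊆ Ω, IsOpen Ω' ∧ y₀ ∈ Ω' ∧ ∃ s : V → P, ContDiffOn ℝ ∞ s Ω' ∧ s y₀ = k ∧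
      (∀ y ∈ Ω', L y (s y) = 0) ∧ ∀ y ∈ Ω', finrank ℝ (LinearMap.range (L y).toLinearMap) =
        finrank ℝ (LinearMap.range (L y₀).toLinearMap) := by
  set K := LinearMap.ker (L y₀).toLinearMap with hK
  obtain ⟨C, hC⟩ := Submodule.exists_isCompl K
  have hker : LinearMap.ker ((L y₀).toLinearMap ∘ₗ C.subtype) = ⊥ := by
    rw [LinearMap.ker_eq_bot']
    intro c hc
    have : (c : P) ∈ K ⊓ C := ⟨hc, c.2⟩
    rw [hC.inf_eq_bot] at this
    simpa using this
  obtain ⟨S, hS⟩ := LinearMap.exists_leftInverse_of_injective _ hker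
  have hS' : ∀ c : C, S (L y₀ c) = c := fun c => LinearMap.congr_fun hS c
  let S' : Q →L[ℝ] P := LinearMap.toContinuousLinearMap (C.subtype ∘ₗ S)
  let T : P →L[ℝ] P := LinearMap.toContinuousLinearMap (K.projection C hC)
  -- `Φ y₀` is the identity, so `Φ y` is invertible nearby, and the section is `(Φ y)⁻¹ k`. As k
  -- lies in K, the C-component `S' (L y (s y))` vanishes; maximality of the rank upgrades this to
  -- `L y (s y) = 0`.
  let Φ : V → P →L[ℝ] P := fun y => T + S'.comp (L y)
  have hTK : ∀ p, T p ∈ K := fun p => Submodule.projection_apply_mem hC p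
  have hSC : ∀ w, S' w ∈ C := fun w => (S w).2
  have hdisj : ∀ a ∈ K, ∀ b ∈ C, a + b = k → b = 0 := by
    intro a ha b hb hab
    have : b ∈ K ⊓ C := ⟨by
      have : b = k - a := by rw [← hab]; abel
      rw [this]; exact K.sub_mem hk ha, hb⟩
    rw [hC.inf_eq_bot] at this
    simpa using this
  have hΦ0 : Φ y₀ = 1 := by
    ext p
    have h1 := Submodule.projection_add_projection_eq_self hC p
    have h2 : L y₀ p = L y₀ (C.projection K hC.symm p) := by
      conv_lhs => rw [← h1]
      rw [map_add, show L y₀ (K.projection C hC p) = 0 from hTK p, zero_add]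
    have h3 : S' (L y₀ p) = C.projection K hC.symm p := by
      rw [h2]
      exact congrArg Subtype.val (hS' ⟨_, Submodule.projection_apply_mem hC.symm p⟩)
    change T p + S' (L y₀ p) = p
    rw [h3]
    exact h1
  have hΦc : ContDiffOn ℝ ∞ Φ Ω := contDiffOn_const.add (contDiffOn_const.clm_comp hL)
  let Ω' := Ω ∩ Φ ⁻¹' {A | IsUnit A}
  have hΩ' : IsOpen Ω' := hΦc.continuousOn.isOpen_inter_preimage hΩ Units.isOpen
  have hkey : ∀ y ∈ Ω', (LinearMap.ker (L y).toLinearMap =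
        LinearMap.ker (S'.comp (L y)).toLinearMap) ∧
      finrank ℝ (LinearMap.range (L y).toLinearMap) =
        finrank ℝ (LinearMap.range (L y₀).toLinearMap) := by
    intro y hy
    have hinj : Function.Injective (Φ y) := by
      have := Ring.inverse_mul_cancel (Φ y) hy.2
      exact Function.LeftInverse.injective (g := (Ring.inverse (Φ y) : P →L[ℝ] P))
        fun p => congrArg (fun A : P →L[ℝ] P => A p) this
    set K' := LinearMap.ker (S'.comp (L y)).toLinearMap with hK'
    have hle : LinearMap.ker (L y).toLinearMap ≤ K' := fun p hp => by
      change S' (L y p) = 0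
      rw [show L y p = 0 from hp, map_zero]
    -- On `K'` the map `Φ y` reduces to `T`, so it embeds `K'` in `K`. Maximal rank at y₀ gives `dim
    -- K ≤ dim ker (L y)`, and the inclusion of `ker (L y)` in `K'` becomes an equality.
    have hmap : Submodule.map (Φ y).toLinearMap K' ≤ K := by
      rintro _ ⟨p, hp, rfl⟩
      change T p + S' (L y p) ∈ K
      rw [show S' (L y p) = 0 from hp, add_zero]
      exact hTK p
    have h1 := Submodule.finrank_mono hmap
    rw [← (Submodule.equivMapOfInjective (Φ y).toLinearMap hinj K').finrank_eq] at h1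
    have h2 := LinearMap.finrank_range_add_finrank_ker (L y).toLinearMap
    have h3 := LinearMap.finrank_range_add_finrank_ker (L y₀).toLinearMap
    have h4 := hmax y hy.1
    rw [← hK] at h3
    have h5 : LinearMap.ker (L y).toLinearMap = K' :=
      Submodule.eq_of_le_of_finrank_le hle (by
        refine h1.trans ?_
        omega)
    refine ⟨h5, le_antisymm h4 ?_⟩
    have h6 := (Submodule.finrank_mono hle).trans h1
    omega
  refine ⟨Ω', Set.inter_subset_left, hΩ', ⟨hy₀, by simp [hΦ0]⟩, fun y => Ring.inverse (Φ y) k,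
    ?_, ?_, ?_, fun y hy => (hkey y hy).2⟩
  · intro y hy
    obtain ⟨u, hu⟩ := hy.2
    have h1 : ContDiffAt ℝ ∞ Ring.inverse (Φ y) := hu ▸ contDiffAt_ringInverse ℝ u
    have h2 : ContDiffAt ℝ ∞ Φ y := hΦc.contDiffAt (hΩ.mem_nhds hy.1)
    exact ((h1.comp y h2).clm_apply contDiffAt_const).contDiffWithinAt
  · simp only [hΦ0, Ring.inverse_one, one_apply_eq_self]
  · intro y hy
    set s := Ring.inverse (Φ y) k with hs
    have hΦs : Φ y s = k := by
      have := Ring.mul_inverse_cancel (Φ y) hy.2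
      exact congrArg (fun A : P →L[ℝ] P => A k) this
    have h6 : s ∈ LinearMap.ker (S'.comp (L y)).toLinearMap :=
      hdisj _ (hTK s) _ (hSC _) hΦs
    rw [← (hkey y hy).1] at h6
    exact h6

end MaximalRank

/-! ### Algebra of flat bilinear forms -/

section Pointwise

variable {V E₁ E₂ : Type*} [NormedAddCommGroup V] [NormedSpace ℝ V] [FiniteDimensional ℝ V]
  [NormedAddCommGroup E₁] [InnerProductSpace ℝ E₁] [FiniteDimensional ℝ E₁]
  [NormedAddCommGroup E₂] [InnerProductSpace ℝ E₂] [FiniteDimensional ℝ E₂]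

/-- The map `(X, w) ↦ (H(Y, X) - A w, K(Y, X) - B w)`. Its kernel consists of the `X` for which
the components of `H(Y, X)` and `K(Y, X)` normal to the ranges of `A` and `B` vanish. -/
def pairMap (A : V →L[ℝ] E₁) (B : V →L[ℝ] E₂) (HY : V →L[ℝ] E₁) (KY : V →L[ℝ] E₂) :
    V × V →L[ℝ] E₁ × E₂ :=
  (HY.comp (ContinuousLinearMap.fst ℝ V V) - A.comp (ContinuousLinearMap.snd ℝ V V)).prod
    (KY.comp (ContinuousLinearMap.fst ℝ V V) - B.comp (ContinuousLinearMap.snd ℝ V V))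

@[simp] theorem pairMap_apply (A : V →L[ℝ] E₁) (B : V →L[ℝ] E₂) (HY : V →L[ℝ] E₁)
    (KY : V →L[ℝ] E₂) (z : V × V) :
    pairMap A B HY KY z = (HY z.1 - A z.2, KY z.1 - B z.2) := rfl

theorem contDiffOn_pairMap {n : ℕ∞ω} {Ω : Set V} {A : V → V →L[ℝ] E₁} {B : V → V →L[ℝ] E₂}
    {HY : V → V →L[ℝ] E₁} {KY : V → V →L[ℝ] E₂} (hA : ContDiffOn ℝ n A Ω)
    (hB : ContDiffOn ℝ n B Ω) (hH : ContDiffOn ℝ n HY Ω) (hK : ContDiffOn ℝ n KY Ω) :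
    ContDiffOn ℝ n (fun y => pairMap (A y) (B y) (HY y) (KY y)) Ω := by
  have h : (fun y => pairMap (A y) (B y) (HY y) (KY y)) = fun y =>
      (ContinuousLinearMap.inl ℝ E₁ E₂).comp ((HY y).comp (ContinuousLinearMap.fst ℝ V V) -
        (A y).comp (ContinuousLinearMap.snd ℝ V V)) +
      (ContinuousLinearMap.inr ℝ E₁ E₂).comp ((KY y).comp (ContinuousLinearMap.fst ℝ V V) -
        (B y).comp (ContinuousLinearMap.snd ℝ V V)) := by
    funext y
    refine ContinuousLinearMap.ext fun z => Prod.ext ?_ ?_ <;> simp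
  rw [h]
  exact (contDiffOn_const.clm_comp
      ((hH.clm_comp contDiffOn_const).sub (hA.clm_comp contDiffOn_const))).add
    (contDiffOn_const.clm_comp
      ((hK.clm_comp contDiffOn_const).sub (hB.clm_comp contDiffOn_const)))

/-- Working modulo the ranges of A and B avoids splitting off normal spaces. The range of `pairMap`
is killed by the functional δ(u, u') = ⟨u, A ·⟩ - ⟨u', B ·⟩, whose rank is at least dim V because A
is injective. So the kernel has dimension at least 3 dim V - dim E₁ - dim E₂. -/
theorem exists_ker_pairMap (A : V →L[ℝ] E₁) (B : V →L[ℝ] E₂) (HY : V →L[ℝ] E₁)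
    (KY : V →L[ℝ] E₂) (hA : Function.Injective A)
    (hAB : ∀ u w, ⟪A u, A w⟫ = ⟪B u, B w⟫) (hHK : ∀ u w, ⟪HY u, A w⟫ = ⟪KY u, B w⟫)
    (hdim : finrank ℝ E₁ + finrank ℝ E₂ < 3 * finrank ℝ V) :
    ∃ X w : V, X ≠ 0 ∧ HY X = A w ∧ KY X = B w := by
  let δ : E₁ × E₂ →ₗ[ℝ] (V →ₗ[ℝ] ℝ) := LinearMap.coprod
    ((innerₗ E₁ : E₁ →ₗ[ℝ] E₁ →ₗ[ℝ] ℝ).compl₂ A.toLinearMap)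
    (-((innerₗ E₂ : E₂ →ₗ[ℝ] E₂ →ₗ[ℝ] ℝ).compl₂ B.toLinearMap))
  have hδ : ∀ u u' w, δ (u, u') w = ⟪u, A w⟫ - ⟪u', B w⟫ := by
    intro u u' w
    simp [δ, sub_eq_add_neg]
  have hrange : LinearMap.range (pairMap A B HY KY).toLinearMap ≤ LinearMap.ker δ := by
    rintro _ ⟨z, rfl⟩
    rw [LinearMap.mem_ker]
    ext w
    have := hδ (HY z.1 - A z.2) (KY z.1 - B z.2) w
    rw [inner_sub_left, inner_sub_left, hAB, hHK] at this
    simpa using this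
  have hδr : finrank ℝ V ≤ finrank ℝ (LinearMap.range δ) := by
    let τ : V →ₗ[ℝ] (LinearMap.range δ) :=
      δ.rangeRestrict ∘ₗ LinearMap.inl ℝ E₁ E₂ ∘ₗ A.toLinearMap
    have : Function.Injective τ := by
      refine (injective_iff_map_eq_zero τ).mpr fun v hv => ?_
      have h1 : δ (A v, 0) = 0 := congrArg Subtype.val hv
      have h2 := hδ (A v) 0 v
      rw [h1] at h2
      have h3 : A v = 0 := by simpa using h2.symm
      exact hA (by rw [h3, map_zero])
    exact LinearMap.finrank_le_finrank_of_injective this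
  have h1 := Submodule.finrank_mono hrange
  have h2 := LinearMap.finrank_range_add_finrank_ker δ
  have h3 := LinearMap.finrank_range_add_finrank_ker (pairMap A B HY KY).toLinearMap
  rw [finrank_prod] at h2 h3
  have h4 : LinearMap.ker (pairMap A B HY KY).toLinearMap ≠ ⊥ := by
    intro h
    rw [h, finrank_bot] at h3
    omega
  obtain ⟨z, hz, hz0⟩ := Submodule.exists_mem_ne_zero_of_ne_bot h4
  have hz' : (HY z.1 - A z.2, KY z.1 - B z.2) = (0, 0) := hz
  rw [Prod.mk.injEq, sub_eq_zero, sub_eq_zero] at hz'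
  -- The component `z.1` of a nonzero kernel vector cannot vanish: otherwise `A z.2 = 0` and
  -- injectivity of A forces `z.2 = 0`.
  refine ⟨z.1, z.2, fun h => hz0 (Prod.ext h (hA ?_)), hz'.1, hz'.2⟩
  rw [← hz'.1, h, map_zero, Prod.snd_zero, map_zero]

/-- If `Y` is a regular element and `X ∈ ker`, then `⟪H(Z, X), H(Z', X)⟫ = ⟪K(Z, X), K(Z', X)⟫`. -/
theorem inner_eq_of_mem_ker_of_maximal (A : V →L[ℝ] E₁) (B : V →L[ℝ] E₂) (H : V →L[ℝ] V →L[ℝ] E₁)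
    (K : V →L[ℝ] V →L[ℝ] E₂)
    (hHK : ∀ u v w, ⟪H u v, A w⟫ = ⟪K u v, B w⟫)
    (hflat : ∀ a b c d, ⟪H a b, H c d⟫ - ⟪H c b, H a d⟫ = ⟪K a b, K c d⟫ - ⟪K c b, K a d⟫)
    (Y : V)
    (hmax : ∀ Y', finrank ℝ (LinearMap.range (pairMap A B (H Y') (K Y')).toLinearMap) ≤
      finrank ℝ (LinearMap.range (pairMap A B (H Y) (K Y)).toLinearMap))
    (X w : V) (h₁ : H Y X = A w) (h₂ : K Y X = B w) (Z Z' : V) :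
    ⟪H Z X, H Z' X⟫ = ⟪K Z X, K Z' X⟫ := by
  -- `pairMap` is affine in Y, with A and B in its constant part; hence the zeros in the direction
  -- of the pencil.
  have hpencil : ∀ t : ℝ, pairMap A B (H Y) (K Y) + t • pairMap 0 0 (H Z') (K Z') =
      pairMap A B (H (Y + t • Z')) (K (Y + t • Z')) := by
    intro t
    refine ContinuousLinearMap.ext fun z => Prod.ext ?_ ?_
    · change H Y z.1 - A z.2 + t • (H Z' z.1 - 0) = H (Y + t • Z') z.1 - A z.2
      rw [map_add, map_smul, add_apply, smul_apply,
        sub_zero]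
      abel
    · change K Y z.1 - B z.2 + t • (K Z' z.1 - 0) = K (Y + t • Z') z.1 - B z.2
      rw [map_add, map_smul, add_apply, smul_apply,
        sub_zero]
      abel
  -- Maximality of the rank at Y writes `H Z' X` and `K Z' X` as `H Y W` and `K Y W` up to
  -- tangential terms, with the same W and w' for both.
  obtain ⟨⟨W, w'⟩, hz⟩ := map_ker_subset_range_of_finrank_le (pairMap A B (H Y) (K Y))
    (pairMap 0 0 (H Z') (K Z')) (fun t => by
      rw [hpencil]
      exact hmax _) (X, w) (by simp [h₁, h₂])
  simp only [pairMap_apply, zero_apply, sub_zero, Prod.mk.injEq] at hz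
  rw [hz.1, hz.2, inner_sub_right, inner_sub_right, hHK Z X w']
  -- Flatness exchanges Z and Y. Since `H Y X` and `K Y X` are tangential, the exchanged terms
  -- agree.
  have := hflat Z X Y W
  rw [h₁, h₂, real_inner_comm (H Z W), real_inner_comm (K Z W), hHK] at this
  linarith

end Pointwise

/-! ### Second derivatives of isometric maps and the isotropic field -/

section Local

variable {V E₁ E₂ : Type*} [NormedAddCommGroup V] [NormedSpace ℝ V] [FiniteDimensional ℝ V]
  [NormedAddCommGroup E₁] [InnerProductSpace ℝ E₁] [FiniteDimensional ℝ E₁]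
  [NormedAddCommGroup E₂] [InnerProductSpace ℝ E₂] [FiniteDimensional ℝ E₂]

theorem fderiv_fderiv_comm {E : Type*} [NormedAddCommGroup E] [NormedSpace ℝ E] {h : V → E} {y : V}
    (hh : ContDiffAt ℝ ∞ h y) (u v : V) :
    fderiv ℝ (fderiv ℝ h) y u v = fderiv ℝ (fderiv ℝ h) y v u :=
  (hh.isSymmSndFDerivAt (by
    rw [minSmoothness_of_isRCLikeNormedField]
    exact WithTop.coe_le_coe.2 (le_top : (2 : ℕ∞) ≤ ⊤))).eq u v

theorem differentiableAt_fderiv {E : Type*} [NormedAddCommGroup E] [NormedSpace ℝ E] {h : V → E}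
    {y : V} (hh : ContDiffAt ℝ ∞ h y) : DifferentiableAt ℝ (fderiv ℝ h) y :=
  (hh.fderiv_right (m := ∞) (by simp)).differentiableAt (by simp)

theorem fderiv_inner_fderiv {E : Type*} [NormedAddCommGroup E] [InnerProductSpace ℝ E] {h : V → E}
    {y : V} (hh : ContDiffAt ℝ ∞ h y) (a u w : V) :
    fderiv ℝ (fun z => ⟪fderiv ℝ h z u, fderiv ℝ h z w⟫) y a =
      ⟪fderiv ℝ h y u, fderiv ℝ (fderiv ℝ h) y a w⟫ +
        ⟪fderiv ℝ (fderiv ℝ h) y a u, fderiv ℝ h y w⟫ := by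
  have hd := differentiableAt_fderiv hh
  rw [fderiv_inner_apply ℝ (hd.clm_apply (differentiableAt_const u))
    (hd.clm_apply (differentiableAt_const w)), fderiv_clm_apply hd (differentiableAt_const u),
    fderiv_clm_apply hd (differentiableAt_const w)]
  simp

theorem fderiv_inner_fderiv_fderiv {E : Type*} [NormedAddCommGroup E] [InnerProductSpace ℝ E]
    {h : V → E} {y : V} (hh : ContDiffAt ℝ ∞ h y) (a b c d : V) :
    fderiv ℝ (fun z => ⟪fderiv ℝ (fderiv ℝ h) z a b, fderiv ℝ h z d⟫) y c =
      ⟪fderiv ℝ (fderiv ℝ h) y a b, fderiv ℝ (fderiv ℝ h) y c d⟫ +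
        ⟪fderiv ℝ (fderiv ℝ (fderiv ℝ h)) y c a b, fderiv ℝ h y d⟫ := by
  have hd := differentiableAt_fderiv hh
  have hd2 := differentiableAt_fderiv (hh.fderiv_right (m := ∞) (by simp))
  rw [fderiv_inner_apply ℝ ((hd2.clm_apply (differentiableAt_const a)).clm_apply
      (differentiableAt_const b)) (hd.clm_apply (differentiableAt_const d)),
    fderiv_clm_apply (hd2.clm_apply (differentiableAt_const a)) (differentiableAt_const b),
    fderiv_clm_apply hd2 (differentiableAt_const a), fderiv_clm_apply hd (differentiableAt_const d)]
  simp

variable {Ω : Set V} {h : V → E₁} {k : V → E₂}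

/-- The tangential part of the second derivative is determined by the induced metric. -/
theorem inner_fderiv_fderiv_eq (hΩ : IsOpen Ω) (hh : ContDiffOn ℝ ∞ h Ω) (hk : ContDiffOn ℝ ∞ k Ω)
    (hiso : ∀ y ∈ Ω, ∀ u w, ⟪fderiv ℝ h y u, fderiv ℝ h y w⟫ = ⟪fderiv ℝ k y u, fderiv ℝ k y w⟫)
    {y : V} (hy : y ∈ Ω) (u v w : V) :
    ⟪fderiv ℝ (fderiv ℝ h) y u v, fderiv ℝ h y w⟫ =
      ⟪fderiv ℝ (fderiv ℝ k) y u v, fderiv ℝ k y w⟫ := by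
  have hhy := hh.contDiffAt (hΩ.mem_nhds hy)
  have hky := hk.contDiffAt (hΩ.mem_nhds hy)
  have hD : ∀ a u w, ⟪fderiv ℝ h y u, fderiv ℝ (fderiv ℝ h) y a w⟫ +
        ⟪fderiv ℝ (fderiv ℝ h) y a u, fderiv ℝ h y w⟫ =
      ⟪fderiv ℝ k y u, fderiv ℝ (fderiv ℝ k) y a w⟫ +
        ⟪fderiv ℝ (fderiv ℝ k) y a u, fderiv ℝ k y w⟫ := by
    intro a u w
    rw [← fderiv_inner_fderiv hhy, ← fderiv_inner_fderiv hky]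
    have : (fun z => ⟪fderiv ℝ h z u, fderiv ℝ h z w⟫) =ᶠ[𝓝 y]
        fun z => ⟪fderiv ℝ k z u, fderiv ℝ k z w⟫ :=
      Filter.eventuallyEq_of_mem (hΩ.mem_nhds hy) fun z hz => hiso z hz u w
    rw [this.fderiv_eq]
  -- Koszul's argument: three cyclic derivatives of the metric and the symmetry of second
  -- derivatives determine the tangential part.
  have h1 := hD u v w
  have h2 := hD v w u
  have h3 := hD w u v
  rw [fderiv_fderiv_comm hhy v w, fderiv_fderiv_comm hky v w, fderiv_fderiv_comm hhy v u,
    fderiv_fderiv_comm hky v u] at h2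
  rw [fderiv_fderiv_comm hhy w u, fderiv_fderiv_comm hky w u] at h3
  simp only [real_inner_comm (fderiv ℝ h y _), real_inner_comm (fderiv ℝ k y _)] at h1 h2 h3 ⊢
  linarith

/-- The Gauss equation for two maps inducing the same metric. -/
theorem inner_fderiv_fderiv_sub_eq (hΩ : IsOpen Ω) (hh : ContDiffOn ℝ ∞ h Ω)
    (hk : ContDiffOn ℝ ∞ k Ω)
    (hiso : ∀ y ∈ Ω, ∀ u w, ⟪fderiv ℝ h y u, fderiv ℝ h y w⟫ = ⟪fderiv ℝ k y u, fderiv ℝ k y w⟫)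
    {y : V} (hy : y ∈ Ω) (a b c d : V) :
    ⟪fderiv ℝ (fderiv ℝ h) y a b, fderiv ℝ (fderiv ℝ h) y c d⟫ -
        ⟪fderiv ℝ (fderiv ℝ h) y c b, fderiv ℝ (fderiv ℝ h) y a d⟫ =
      ⟪fderiv ℝ (fderiv ℝ k) y a b, fderiv ℝ (fderiv ℝ k) y c d⟫ -
        ⟪fderiv ℝ (fderiv ℝ k) y c b, fderiv ℝ (fderiv ℝ k) y a d⟫ := by
  have hhy := hh.contDiffAt (hΩ.mem_nhds hy)
  have hky := hk.contDiffAt (hΩ.mem_nhds hy)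
  have hD : ∀ a b c d, fderiv ℝ (fun z => ⟪fderiv ℝ (fderiv ℝ h) z a b, fderiv ℝ h z d⟫) y c =
      fderiv ℝ (fun z => ⟪fderiv ℝ (fderiv ℝ k) z a b, fderiv ℝ k z d⟫) y c := by
    intro a b c d
    have : (fun z => ⟪fderiv ℝ (fderiv ℝ h) z a b, fderiv ℝ h z d⟫) =ᶠ[𝓝 y]
        fun z => ⟪fderiv ℝ (fderiv ℝ k) z a b, fderiv ℝ k z d⟫ :=
      Filter.eventuallyEq_of_mem (hΩ.mem_nhds hy)
        fun z hz => inner_fderiv_fderiv_eq hΩ hh hk hiso hz a b d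
    rw [this.fderiv_eq]
  -- Antisymmetrising in a and c cancels the third derivatives, which are the only terms not
  -- quadratic in the second ones.
  have h1 := hD a b c d
  have h2 := hD c b a d
  rw [fderiv_inner_fderiv_fderiv hhy, fderiv_inner_fderiv_fderiv hky] at h1 h2
  rw [fderiv_fderiv_comm (hhy.fderiv_right (m := ∞) (by simp)) a c,
    fderiv_fderiv_comm (hky.fderiv_right (m := ∞) (by simp)) a c] at h2
  linarith

/-- Near some point there is a nowhere vanishing smooth vector field along which the second
derivatives, hence the second fundamental forms, have equal inner products. -/
theorem exists_isotropic_field (hΩ : IsOpen Ω) (hne : Ω.Nonempty) (hh : ContDiffOn ℝ ∞ h Ω)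
    (hk : ContDiffOn ℝ ∞ k Ω) (hinj : ∀ y ∈ Ω, Function.Injective (fderiv ℝ h y))
    (hiso : ∀ y ∈ Ω, ∀ u w, ⟪fderiv ℝ h y u, fderiv ℝ h y w⟫ = ⟪fderiv ℝ k y u, fderiv ℝ k y w⟫)
    (hdim : finrank ℝ E₁ + finrank ℝ E₂ < 3 * finrank ℝ V) :
    ∃ Ω' ⊆ Ω, IsOpen Ω' ∧ ∃ y₀ ∈ Ω', ∃ X : V → V, ContDiffOn ℝ ∞ X Ω' ∧ X y₀ ≠ 0 ∧
      ∀ y ∈ Ω', ∀ Z Z', ⟪fderiv ℝ (fderiv ℝ h) y Z (X y), fderiv ℝ (fderiv ℝ h) y Z' (X y)⟫ =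
        ⟪fderiv ℝ (fderiv ℝ k) y Z (X y), fderiv ℝ (fderiv ℝ k) y Z' (X y)⟫ := by
  let L : V → V → V × V →L[ℝ] E₁ × E₂ := fun Y y => pairMap (fderiv ℝ h y) (fderiv ℝ k y)
    (fderiv ℝ (fderiv ℝ h) y Y) (fderiv ℝ (fderiv ℝ k) y Y)
  -- The rank is maximised over the points and the directions together. One constant direction Y
  -- then stays of maximal rank at all points near y₀, as the pointwise lemma requires.
  let R : Set ℕ := {r | ∃ y ∈ Ω, ∃ Y, finrank ℝ (LinearMap.range (L Y y).toLinearMap) = r}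
  have hR : R.Nonempty := hne.imp' (fun y => finrank ℝ (LinearMap.range (L 0 y).toLinearMap))
    fun y hy => ⟨y, hy, 0, rfl⟩
  have hRb : BddAbove R := ⟨finrank ℝ (E₁ × E₂), by
    rintro _ ⟨y, _, Y, rfl⟩
    exact Submodule.finrank_le _⟩
  obtain ⟨y₀, hy₀, Y, hY⟩ := Nat.sSup_mem hR hRb
  have hmax : ∀ y ∈ Ω, ∀ Y', finrank ℝ (LinearMap.range (L Y' y).toLinearMap) ≤
      finrank ℝ (LinearMap.range (L Y y₀).toLinearMap) := fun y hy Y' =>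
    hY ▸ le_csSup hRb ⟨y, hy, Y', rfl⟩
  have hh1 := hh.fderiv_of_isOpen (m := ∞) hΩ (by simp)
  have hk1 := hk.fderiv_of_isOpen (m := ∞) hΩ (by simp)
  have hh2 := hh1.fderiv_of_isOpen (m := ∞) hΩ (by simp)
  have hk2 := hk1.fderiv_of_isOpen (m := ∞) hΩ (by simp)
  have hL : ContDiffOn ℝ ∞ (L Y) Ω := contDiffOn_pairMap hh1 hk1 (hh2.clm_apply contDiffOn_const)
    (hk2.clm_apply contDiffOn_const)
  obtain ⟨X₀, w₀, hX₀, hX₁, hX₂⟩ := exists_ker_pairMap (fderiv ℝ h y₀) (fderiv ℝ k y₀)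
    (fderiv ℝ (fderiv ℝ h) y₀ Y) (fderiv ℝ (fderiv ℝ k) y₀ Y) (hinj y₀ hy₀) (hiso y₀ hy₀)
    (inner_fderiv_fderiv_eq hΩ hh hk hiso hy₀ Y) hdim
  obtain ⟨Ω', hsub, hΩ', hmem, s, hs, hs0, hker, hrk⟩ :=
    exists_smooth_kernel_section hΩ (L Y) hL hy₀ (fun y hy => hmax y hy Y) (X₀, w₀)
      (by simp [L, hX₁, hX₂])
  refine ⟨Ω', hsub, hΩ', y₀, hmem, fun y => (s y).1, contDiff_fst.comp_contDiffOn hs,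
    by simpa [hs0] using hX₀, fun y hy Z Z' => ?_⟩
  have hz := hker y hy
  simp only [L, pairMap_apply, Prod.mk_eq_zero, sub_eq_zero] at hz
  exact inner_eq_of_mem_ker_of_maximal (fderiv ℝ h y) (fderiv ℝ k y) _ _
    (inner_fderiv_fderiv_eq hΩ hh hk hiso (hsub hy))
    (inner_fderiv_fderiv_sub_eq hΩ hh hk hiso (hsub hy)) Y
    (fun Y' => (hmax y (hsub hy) Y').trans (hrk y hy).ge) _ _ hz.1 hz.2 Z Z'

/-! ### Local ruled extensions -/

/-- The differential `(W, c) ↦ A W + t B W + c v` of a ruled map `(y, t) ↦ h y + t v y`, where `A`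
and `B` are the differentials of `h` and `v`. -/
def ruledMap {E : Type*} [NormedAddCommGroup E] [NormedSpace ℝ E] (A B : V →L[ℝ] E) (v : E)
    (t : ℝ) : V × ℝ →L[ℝ] E :=
  A.comp (ContinuousLinearMap.fst ℝ V ℝ) + (t • B.comp (ContinuousLinearMap.fst ℝ V ℝ) +
    (ContinuousLinearMap.snd ℝ V ℝ).smulRight v)

theorem ruledMap_apply {E : Type*} [NormedAddCommGroup E] [NormedSpace ℝ E] (A B : V →L[ℝ] E)
    (v : E) (t : ℝ) (z : V × ℝ) : ruledMap A B v t z = A z.1 + (t • B z.1 + z.2 • v) := rfl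

/-- Along an isotropic field `X` the ruled extensions `h + t Dh(X)` and `k + t Dk(X)` induce the
same metric. -/
theorem inner_ruled_eq (D : V →L[ℝ] V) (P : V →L[ℝ] E₁) (Q : V →L[ℝ] E₂) (H : V →L[ℝ] E₁)
    (K : V →L[ℝ] E₂) (hPQ : ∀ u w, ⟪P u, P w⟫ = ⟪Q u, Q w⟫) (hHK : ∀ u w, ⟪H u, P w⟫ = ⟪K u, Q w⟫)
    (hII : ∀ u w, ⟪H u, H w⟫ = ⟪K u, K w⟫) (X W W' : V) (t c c' : ℝ) :
    ⟪P W + (t • (H W + P (D W)) + c • P X), P W' + (t • (H W' + P (D W')) + c' • P X)⟫ =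
      ⟪Q W + (t • (K W + Q (D W)) + c • Q X), Q W' + (t • (K W' + Q (D W')) + c' • Q X)⟫ := by
  -- Separate a tangential vector, the same for both maps, from `t • H W`. The products are then
  -- matched by the isometry, by the equal tangential parts of second derivatives, and by isotropy.
  have h1 : ∀ W (c : ℝ), P W + (t • (H W + P (D W)) + c • P X) =
      P (W + t • D W + c • X) + t • H W := by
    intro W c
    simp only [map_add, map_smul, smul_add]
    abel
  have h2 : ∀ W (c : ℝ), Q W + (t • (K W + Q (D W)) + c • Q X) =
      Q (W + t • D W + c • X) + t • K W := by
    intro W c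
    simp only [map_add, map_smul, smul_add]
    abel
  have hHK' : ∀ u w, ⟪P u, H w⟫ = ⟪Q u, K w⟫ := fun u w => by
    rw [real_inner_comm, hHK, real_inner_comm]
  rw [h1, h1, h2, h2]
  simp only [inner_add_left, inner_add_right, real_inner_smul_left, real_inner_smul_right, hPQ, hHK,
    hHK', hII]

/-- Two isometric maps of an open set have, near some point, ruled extensions that are isometric
and immersive off the original maps. -/
theorem exists_local_ruled_extension (hΩ : IsOpen Ω) (hne : Ω.Nonempty) (hh : ContDiffOn ℝ ∞ h Ω)
    (hk : ContDiffOn ℝ ∞ k Ω) (hinj : ∀ y ∈ Ω, Function.Injective (fderiv ℝ h y))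
    (hiso : ∀ y ∈ Ω, ∀ u w, ⟪fderiv ℝ h y u, fderiv ℝ h y w⟫ = ⟪fderiv ℝ k y u, fderiv ℝ k y w⟫)
    (hII : ∀ y ∈ Ω, ∀ X, X ≠ 0 → ∀ w, fderiv ℝ (fderiv ℝ h) y X X ≠ fderiv ℝ h y w)
    (hdim : finrank ℝ E₁ + finrank ℝ E₂ < 3 * finrank ℝ V) :
    ∃ Ω' ⊆ Ω, IsOpen Ω' ∧ Ω'.Nonempty ∧ ∃ (v : V → E₁) (v' : V → E₂), ContDiffOn ℝ ∞ v Ω' ∧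
      ContDiffOn ℝ ∞ v' Ω' ∧ ∀ y ∈ Ω', ∀ t : ℝ, |t| < 2 →
        (∀ z z', ⟪ruledMap (fderiv ℝ h y) (fderiv ℝ v y) (v y) t z,
            ruledMap (fderiv ℝ h y) (fderiv ℝ v y) (v y) t z'⟫ =
          ⟪ruledMap (fderiv ℝ k y) (fderiv ℝ v' y) (v' y) t z,
            ruledMap (fderiv ℝ k y) (fderiv ℝ v' y) (v' y) t z'⟫) ∧
        (t ≠ 0 → Function.Injective (ruledMap (fderiv ℝ h y) (fderiv ℝ v y) (v y) t)) := by
  obtain ⟨Ω₁, hsub, hΩ₁, y₀, hy₀, X, hX, hX0, hiso2⟩ :=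
    exists_isotropic_field hΩ hne hh hk hinj hiso hdim
  have hh1 := (hh.fderiv_of_isOpen (m := ∞) hΩ (by simp)).mono hsub
  have hk1 := (hk.fderiv_of_isOpen (m := ∞) hΩ (by simp)).mono hsub
  set v : V → E₁ := fun y => fderiv ℝ h y (X y) with hv
  set v' : V → E₂ := fun y => fderiv ℝ k y (X y) with hv'
  have hvc : ContDiffOn ℝ ∞ v Ω₁ := hh1.clm_apply hX
  have hvc' : ContDiffOn ℝ ∞ v' Ω₁ := hk1.clm_apply hX
  have hDX : ∀ y ∈ Ω₁, DifferentiableAt ℝ X y := fun y hy =>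
    (hX.contDiffAt (hΩ₁.mem_nhds hy)).differentiableAt (by simp)
  have hDv : ∀ y ∈ Ω₁, HasFDerivAt v (fderiv ℝ v y) y := fun y hy =>
    ((hvc.contDiffAt (hΩ₁.mem_nhds hy)).differentiableAt (by simp)).hasFDerivAt
  have hDv' : ∀ y ∈ Ω₁, HasFDerivAt v' (fderiv ℝ v' y) y := fun y hy =>
    ((hvc'.contDiffAt (hΩ₁.mem_nhds hy)).differentiableAt (by simp)).hasFDerivAt
  have hvD : ∀ y ∈ Ω₁, ∀ W, fderiv ℝ v y W =
      fderiv ℝ (fderiv ℝ h) y W (X y) + fderiv ℝ h y (fderiv ℝ X y W) := fun y hy W => by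
    rw [hv, fderiv_clm_apply (differentiableAt_fderiv (hh.contDiffAt (hΩ.mem_nhds (hsub hy))))
      (hDX y hy)]
    simp [add_comm]
  have hvD' : ∀ y ∈ Ω₁, ∀ W, fderiv ℝ v' y W =
      fderiv ℝ (fderiv ℝ k) y W (X y) + fderiv ℝ k y (fderiv ℝ X y W) := fun y hy W => by
    rw [hv', fderiv_clm_apply (differentiableAt_fderiv (hk.contDiffAt (hΩ.mem_nhds (hsub hy))))
      (hDX y hy)]
    simp [add_comm]
  -- The ruled differential has kernel vector (-X, 1) at t = 0, so openness of injectivity does not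
  -- apply to it. With v = h_*X, however, it sends (W, c) to S(y, t)(W + cX, tc), and S is injective
  -- at (y₀, 0) exactly because X is not asymptotic there.
  let S : V × ℝ → V × ℝ →L[ℝ] E₁ := fun q =>
    (fderiv ℝ h q.1).comp (ContinuousLinearMap.fst ℝ V ℝ) +
      (q.2 • (fderiv ℝ v q.1).comp (ContinuousLinearMap.fst ℝ V ℝ) -
        (ContinuousLinearMap.snd ℝ V ℝ).smulRight (fderiv ℝ v q.1 (X q.1)))
  have hS : ∀ q z, S q z = fderiv ℝ h q.1 z.1 +
      (q.2 • fderiv ℝ v q.1 z.1 - z.2 • fderiv ℝ v q.1 (X q.1)) := fun q z => rfl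
  have hScont : ContinuousAt S (y₀, 0) := by
    have hf : ContinuousAt (fun q : V × ℝ => q.1) (y₀, (0 : ℝ)) := continuousAt_fst
    have h1 : ContinuousAt (fun q : V × ℝ => fderiv ℝ h q.1) (y₀, 0) :=
      ContinuousAt.comp (f := fun q : V × ℝ => q.1)
        (hh1.continuousOn.continuousAt (hΩ₁.mem_nhds hy₀)) hf
    have h2 : ContinuousAt (fun q : V × ℝ => fderiv ℝ v q.1) (y₀, 0) :=
      ContinuousAt.comp (f := fun q : V × ℝ => q.1)
        ((hvc.fderiv_of_isOpen (m := ∞) hΩ₁ (by simp)).continuousOn.continuousAt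
          (hΩ₁.mem_nhds hy₀)) hf
    have h3 : ContinuousAt (fun q : V × ℝ => X q.1) (y₀, 0) :=
      ContinuousAt.comp (f := fun q : V × ℝ => q.1)
        (hX.continuousOn.continuousAt (hΩ₁.mem_nhds hy₀)) hf
    have h4 : Continuous fun e : E₁ => (ContinuousLinearMap.snd ℝ V ℝ).smulRight e :=
      (ContinuousLinearMap.smulRightL ℝ (V × ℝ) E₁ (ContinuousLinearMap.snd ℝ V ℝ)).continuous
    exact (h1.clm_comp continuousAt_const).add
      ((continuousAt_snd.smul (h2.clm_comp continuousAt_const)).sub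
        (h4.continuousAt.comp (h2.clm_apply h3)))
  have hS0 : Function.Injective (S (y₀, 0)) := by
    refine (injective_iff_map_eq_zero _).mpr fun z hz => ?_
    have hz1 : fderiv ℝ h y₀ z.1 = z.2 • fderiv ℝ v y₀ (X y₀) := by
      simpa [hS, ← sub_eq_add_neg, sub_eq_zero] using hz
    have hc : z.2 = 0 := by
      by_contra hc
      refine hII y₀ (hsub hy₀) (X y₀) hX0 (z.2⁻¹ • z.1 - fderiv ℝ X y₀ (X y₀)) ?_
      rw [map_sub, map_smul, hz1, inv_smul_smul₀ hc, hvD y₀ hy₀, add_sub_cancel_right]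
    rw [hc, zero_smul] at hz1
    exact Prod.ext (hinj y₀ (hsub hy₀) (by rw [hz1, Prod.fst_zero, map_zero])) hc
  have hSev : ∀ᶠ q in 𝓝 y₀ ×ˢ 𝓝 (0 : ℝ), Function.Injective (S q) := by
    rw [← nhds_prod_eq]
    exact hScont.eventually (ContinuousLinearMap.isOpen_injective.mem_nhds hS0)
  obtain ⟨pa, hpa, pb, hpb, hSinj⟩ := eventually_prod_iff.mp hSev
  obtain ⟨O, hO, hOo, hyO⟩ := eventually_nhds_iff.mp hpa
  obtain ⟨ε, hε, hpb⟩ := Metric.eventually_nhds_iff.mp hpb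
  have hε2 : (ε / 2) ≠ 0 := by positivity
  -- Scaling the rulings by ε / 2 turns the range |t| < ε into the uniform |t| < 2.
  refine ⟨Ω₁ ∩ O, fun y hy => hsub hy.1, hΩ₁.inter hOo, ⟨y₀, hy₀, hyO⟩,
    fun y => (ε / 2) • v y, fun y => (ε / 2) • v' y, (hvc.const_smul _).mono Set.inter_subset_left,
    (hvc'.const_smul _).mono Set.inter_subset_left, fun y hy t ht => ?_⟩
  have hFz : ∀ z, ruledMap (fderiv ℝ h y) (fderiv ℝ (fun y => (ε / 2) • v y) y) ((ε / 2) • v y) t z =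
      fderiv ℝ h y z.1 + ((t * (ε / 2)) • fderiv ℝ v y z.1 + (z.2 * (ε / 2)) • v y) := fun z => by
    rw [ruledMap_apply, ((hDv y hy.1).fun_const_smul (ε / 2)).fderiv, mul_smul, mul_smul]
    rfl
  have hFz' : ∀ z, ruledMap (fderiv ℝ k y) (fderiv ℝ (fun y => (ε / 2) • v' y) y)
      ((ε / 2) • v' y) t z =
      fderiv ℝ k y z.1 + ((t * (ε / 2)) • fderiv ℝ v' y z.1 + (z.2 * (ε / 2)) • v' y) :=
    fun z => by
      rw [ruledMap_apply, ((hDv' y hy.1).fun_const_smul (ε / 2)).fderiv, mul_smul, mul_smul]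
      rfl
  refine ⟨fun z z' => ?_, fun ht0 => (injective_iff_map_eq_zero _).mpr fun z hz => ?_⟩
  · rw [hFz, hFz, hFz', hFz', hvD y hy.1, hvD y hy.1, hvD' y hy.1, hvD' y hy.1]
    exact inner_ruled_eq (fderiv ℝ X y) (fderiv ℝ h y) (fderiv ℝ k y)
      ((fderiv ℝ (fderiv ℝ h) y).flip (X y)) ((fderiv ℝ (fderiv ℝ k) y).flip (X y))
      (hiso y (hsub hy.1)) (fun u w => inner_fderiv_fderiv_eq hΩ hh hk hiso (hsub hy.1) u _ w)
      (hiso2 y hy.1) _ _ _ _ _ _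
  · rw [hFz] at hz
    have hs : pb (t * (ε / 2)) := hpb (by
      rw [dist_zero_right, Real.norm_eq_abs, abs_mul, abs_of_pos (by positivity : 0 < ε / 2)]
      nlinarith)
    have h1 : S (y, t * (ε / 2)) (z.1 + (z.2 * (ε / 2)) • X y, t * (ε / 2) * (z.2 * (ε / 2))) =
        0 := by
      rw [hS, ← hz]
      simp only [map_add, map_smul, smul_add, mul_smul, hv]
      abel
    have h2 := hSinj (hO y hy.2) hs (h1.trans (map_zero _).symm)
    rw [Prod.mk_eq_zero] at h2
    have h3 : z.2 = 0 := by simpa [ht0, hε2] using h2.2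
    exact Prod.ext (by simpa [h3] using h2.1) h3

end Local

/-! ### Gauss equation and Ricci curvature in coordinates -/

section Ricci

section MatrixInverse

attribute [local instance] Matrix.linftyOpNormedRing Matrix.linftyOpNormedAlgebra

/-- Needed to differentiate the Christoffel symbols. The algebra norm on matrices serves only to
make inversion differentiable; the conclusion concerns entries. -/
theorem differentiableAt_matrix_inv_apply {V : Type*} [NormedAddCommGroup V] [NormedSpace ℝ V]
    {ι : Type*} [Fintype ι] [DecidableEq ι] {G : V → Matrix ι ι ℝ} {y : V}
    (hG : ∀ i j, DifferentiableAt ℝ (fun z => G z i j) y) (hu : IsUnit (G y)) (i j : ι) :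
    DifferentiableAt ℝ (fun z => (G z)⁻¹ i j) y := by
  have : CompleteSpace (Matrix ι ι ℝ) := FiniteDimensional.complete ℝ _
  have h1 : DifferentiableAt ℝ G y := by
    have : G = fun z => ∑ i, ∑ j, G z i j • Matrix.single i j (1 : ℝ) := by
      funext z
      conv_lhs => rw [Matrix.matrix_eq_sum_single (G z)]
      simp
    rw [this]
    exact DifferentiableAt.fun_sum fun i _ => DifferentiableAt.fun_sum fun j _ =>
      (hG i j).smul_const _
  have h2 : DifferentiableAt ℝ (fun z => Ring.inverse (G z)) y :=
    (differentiableAt_inverse hu).comp y h1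
  let ℓ : Matrix ι ι ℝ →L[ℝ] ℝ := LinearMap.toContinuousLinearMap (Matrix.entryLinearMap ℝ ℝ i j)
  have h3 : (fun z => (G z)⁻¹ i j) = fun z => ℓ (Ring.inverse (G z)) := by
    funext z
    rw [Matrix.nonsing_inv_eq_ringInverse]
    rfl
  rw [h3]
  exact ℓ.differentiableAt.comp y h2

end MatrixInverse

/-- Writing P as a sum of rank-one squares turns the double sum into a sum of squared norms. -/
theorem Matrix.PosSemidef.sum_inner_nonneg {ι E : Type*} [Fintype ι] [NormedAddCommGroup E]
    [InnerProductSpace ℝ E] {P : Matrix ι ι ℝ} (hP : P.PosSemidef) (v : ι → E) :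
    0 ≤ ∑ i, ∑ j, P i j * ⟪v i, v j⟫ := by
  obtain ⟨m, A, hA⟩ := Matrix.posSemidef_iff_eq_sum_vecMulVec.mp hP
  have : ∑ i, ∑ j, P i j * ⟪v i, v j⟫ = ∑ r, ⟪∑ i, A r i • v i, ∑ i, A r i • v i⟫ := by
    simp only [sum_inner, inner_sum, real_inner_smul_left, real_inner_smul_right, hA,
      Matrix.sum_apply, Matrix.vecMulVec_apply, Finset.sum_mul, star_trivial]
    rw [Finset.sum_comm]
    simp only [mul_assoc]
    conv_lhs => enter [2, i]; rw [Finset.sum_comm]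
    rw [Finset.sum_comm]
    refine Finset.sum_congr rfl fun r _ => ?_
    exact Finset.sum_congr rfl fun i _ => Finset.sum_congr rfl fun j _ => by
      rw [real_inner_comm, mul_left_comm]
  rw [this]
  exact Finset.sum_nonneg fun r _ => real_inner_self_nonneg

variable {n : ℕ} {E : Type*} [NormedAddCommGroup E] [InnerProductSpace ℝ E]
  {Ω : Set (EuclideanSpace ℝ (Fin n))} {h : EuclideanSpace ℝ (Fin n) → E}
  {G : EuclideanSpace ℝ (Fin n) → Matrix (Fin n) (Fin n) ℝ}

local notation "𝐞" i => EuclideanSpace.single i (1 : ℝ)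

theorem EuclideanSpace.sum_smul_single_one (v : EuclideanSpace ℝ (Fin n)) :
    ∑ i, v i • (𝐞 i) = v := by
  ext j
  simp [Finset.sum_apply, Pi.single_apply]

/-- The metric induced by `h` on `Ω` has coefficients `G`. -/
def IsInducedMetric (Ω : Set (EuclideanSpace ℝ (Fin n))) (h : EuclideanSpace ℝ (Fin n) → E)
    (G : EuclideanSpace ℝ (Fin n) → Matrix (Fin n) (Fin n) ℝ) : Prop :=
  ∀ y ∈ Ω, ∀ i j, G y i j = ⟪fderiv ℝ h y (𝐞 i), fderiv ℝ h y (𝐞 j)⟫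

/-- The vector `∑ₖ Γᵏᵢⱼ eₖ`. -/
noncomputable def christoffelVec (G : EuclideanSpace ℝ (Fin n) → Matrix (Fin n) (Fin n) ℝ)
    (i j : Fin n) (y : EuclideanSpace ℝ (Fin n)) : EuclideanSpace ℝ (Fin n) :=
  ∑ k, christoffel G k i j y • (𝐞 k)

theorem christoffelVec_apply (i j k : Fin n) (y : EuclideanSpace ℝ (Fin n)) :
    christoffelVec G i j y k = christoffel G k i j y := by
  simp [christoffelVec, Finset.sum_apply, Pi.single_apply]

/-- The component `∂ᵢ∂ⱼh - ∑ₖ Γᵏᵢⱼ ∂ₖh` of the second derivative normal to `h`. -/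
noncomputable def secondFundamental (h : EuclideanSpace ℝ (Fin n) → E)
    (G : EuclideanSpace ℝ (Fin n) → Matrix (Fin n) (Fin n) ℝ) (i j : Fin n)
    (y : EuclideanSpace ℝ (Fin n)) : E :=
  fderiv ℝ (fderiv ℝ h) y (𝐞 i) (𝐞 j) - fderiv ℝ h y (christoffelVec G i j y)

namespace IsInducedMetric

variable (hG : IsInducedMetric Ω h G) (hΩ : IsOpen Ω) (hh : ContDiffOn ℝ ∞ h Ω)
include hG

theorem posDef {y : EuclideanSpace ℝ (Fin n)} (hy : y ∈ Ω)
    (hinj : Function.Injective (fderiv ℝ h y)) : (G y).PosDef := by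
  have : G y = Matrix.gram ℝ (fun i => fderiv ℝ h y (𝐞 i)) := by
    ext i j
    rw [hG y hy, Matrix.gram_apply]
  rw [this, Matrix.posDef_gram_iff_linearIndependent]
  have h1 := (EuclideanSpace.basisFun (Fin n) ℝ).toBasis.linearIndependent.map'
    (fderiv ℝ h y).toLinearMap (LinearMap.ker_eq_bot.mpr hinj)
  simpa [Function.comp_def] using h1

include hΩ hh

theorem partialDeriv_eq {y : EuclideanSpace ℝ (Fin n)} (hy : y ∈ Ω) (a i j : Fin n) :
    partialDeriv a (fun z => G z i j) y =
      ⟪fderiv ℝ h y (𝐞 i), fderiv ℝ (fderiv ℝ h) y (𝐞 a) (𝐞 j)⟫ +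
        ⟪fderiv ℝ (fderiv ℝ h) y (𝐞 a) (𝐞 i), fderiv ℝ h y (𝐞 j)⟫ := by
  have : (fun z => G z i j) =ᶠ[𝓝 y] fun z => ⟪fderiv ℝ h z (𝐞 i), fderiv ℝ h z (𝐞 j)⟫ :=
    Filter.eventuallyEq_of_mem (hΩ.mem_nhds hy) fun z hz => hG z hz i j
  rw [partialDeriv, this.fderiv_eq, fderiv_inner_fderiv (hh.contDiffAt (hΩ.mem_nhds hy))]

/-- Each derivative of the metric is a sum of two products; by symmetry of second derivatives all
cancel except one, which occurs twice and absorbs the factor 1/2. -/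
theorem christoffel_eq {y : EuclideanSpace ℝ (Fin n)} (hy : y ∈ Ω) (k i j : Fin n) :
    christoffel G k i j y = ∑ l, (G y)⁻¹ k l *
      ⟪fderiv ℝ (fderiv ℝ h) y (𝐞 i) (𝐞 j), fderiv ℝ h y (𝐞 l)⟫ := by
  have hhy := hh.contDiffAt (hΩ.mem_nhds hy)
  rw [christoffel, Finset.mul_sum]
  refine Finset.sum_congr rfl fun l _ => ?_
  rw [hG.partialDeriv_eq hΩ hh hy, hG.partialDeriv_eq hΩ hh hy, hG.partialDeriv_eq hΩ hh hy,
    fderiv_fderiv_comm hhy (𝐞 l) (𝐞 j), fderiv_fderiv_comm hhy (𝐞 l) (𝐞 i),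
    fderiv_fderiv_comm hhy (𝐞 j) (𝐞 i),
    real_inner_comm (fderiv ℝ (fderiv ℝ h) y (𝐞 i) (𝐞 l)) (fderiv ℝ h y (𝐞 j))]
  ring

omit hΩ hh in
theorem inner_eq_mulVec {y : EuclideanSpace ℝ (Fin n)} (hy : y ∈ Ω) (u : EuclideanSpace ℝ (Fin n))
    (m : Fin n) : ⟪fderiv ℝ h y u, fderiv ℝ h y (𝐞 m)⟫ = (G y).mulVec u m := by
  conv_lhs => rw [← EuclideanSpace.sum_smul_single_one u]
  simp only [map_sum, map_smul, sum_inner, real_inner_smul_left]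
  refine Finset.sum_congr rfl fun k _ => ?_
  change _ = G y m k * u k
  rw [hG y hy, real_inner_comm, mul_comm]

omit hΩ hh in
theorem apply_eq_of_inner {y : EuclideanSpace ℝ (Fin n)} (hy : y ∈ Ω)
    (hinj : Function.Injective (fderiv ℝ h y)) {u : EuclideanSpace ℝ (Fin n)} {c : Fin n → ℝ}
    (hu : ∀ m, ⟪fderiv ℝ h y u, fderiv ℝ h y (𝐞 m)⟫ = c m) (i : Fin n) :
    u i = ∑ m, (G y)⁻¹ i m * c m := by
  have h1 : (G y).mulVec u = c := funext fun m => by rw [← hG.inner_eq_mulVec hy, hu]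
  have h2 : (G y)⁻¹.mulVec c = u := by
    rw [← h1, Matrix.mulVec_mulVec, Matrix.nonsing_inv_mul _
      ((Matrix.isUnit_iff_isUnit_det _).mp (hG.posDef hy hinj).isUnit), Matrix.one_mulVec]
  rw [← h2]
  rfl

/-- The Christoffel symbols are the coefficients of the tangential part of the second derivative, so
`secondFundamental` is normal. -/
theorem inner_christoffelVec {y : EuclideanSpace ℝ (Fin n)} (hy : y ∈ Ω)
    (hinj : Function.Injective (fderiv ℝ h y)) (i j m : Fin n) :
    ⟪fderiv ℝ h y (christoffelVec G i j y), fderiv ℝ h y (𝐞 m)⟫ =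
      ⟪fderiv ℝ (fderiv ℝ h) y (𝐞 i) (𝐞 j), fderiv ℝ h y (𝐞 m)⟫ := by
  have h1 : (christoffelVec G i j y : Fin n → ℝ) = (G y)⁻¹.mulVec fun l =>
      ⟪fderiv ℝ (fderiv ℝ h) y (𝐞 i) (𝐞 j), fderiv ℝ h y (𝐞 l)⟫ := by
    funext k
    rw [christoffelVec_apply, hG.christoffel_eq hΩ hh hy]
    rfl
  rw [hG.inner_eq_mulVec hy, h1, Matrix.mulVec_mulVec, Matrix.mul_nonsing_inv _
      ((Matrix.isUnit_iff_isUnit_det _).mp (hG.posDef hy hinj).isUnit), Matrix.one_mulVec]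

theorem differentiableAt_christoffel {y : EuclideanSpace ℝ (Fin n)} (hy : y ∈ Ω)
    (hinj : Function.Injective (fderiv ℝ h y)) (k i j : Fin n) :
    DifferentiableAt ℝ (christoffel G k i j) y := by
  have hhy := hh.contDiffAt (hΩ.mem_nhds hy)
  have hd := differentiableAt_fderiv hhy
  have hd2 := differentiableAt_fderiv (hhy.fderiv_right (m := ∞) (by simp))
  have h1 : christoffel G k i j =ᶠ[𝓝 y] fun z => ∑ l, (G z)⁻¹ k l *
      ⟪fderiv ℝ (fderiv ℝ h) z (𝐞 i) (𝐞 j), fderiv ℝ h z (𝐞 l)⟫ :=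
    Filter.eventuallyEq_of_mem (hΩ.mem_nhds hy) fun z hz => hG.christoffel_eq hΩ hh hz k i j
  have h2 : ∀ i j, DifferentiableAt ℝ (fun z => G z i j) y := fun i j =>
    ((hd.clm_apply (differentiableAt_const (𝐞 i))).inner ℝ
      (hd.clm_apply (differentiableAt_const (𝐞 j)))).congr_of_eventuallyEq
      (Filter.eventuallyEq_of_mem (hΩ.mem_nhds hy) fun z hz => hG z hz i j)
  refine DifferentiableAt.congr_of_eventuallyEq ?_ h1
  exact DifferentiableAt.fun_sum fun l _ =>
    (differentiableAt_matrix_inv_apply h2 (hG.posDef hy hinj).isUnit k l).mul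
      (((hd2.clm_apply (differentiableAt_const _)).clm_apply (differentiableAt_const _)).inner ℝ
        (hd.clm_apply (differentiableAt_const _)))

theorem hasFDerivAt_christoffelVec {y : EuclideanSpace ℝ (Fin n)} (hy : y ∈ Ω)
    (hinj : Function.Injective (fderiv ℝ h y)) (i j : Fin n) :
    HasFDerivAt (christoffelVec G i j)
      (∑ k, (fderiv ℝ (christoffel G k i j) y).smulRight (𝐞 k)) y := by
  have := HasFDerivAt.fun_sum (u := Finset.univ) (A := fun k z => christoffel G k i j z • (𝐞 k))
    fun k _ => (hG.differentiableAt_christoffel hΩ hh hy hinj k i j).hasFDerivAt.smul_const (𝐞 k)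
  exact this

theorem inner_fderiv_fderiv_vec {y : EuclideanSpace ℝ (Fin n)} (hy : y ∈ Ω)
    (hinj : Function.Injective (fderiv ℝ h y)) (a m : Fin n) (w : EuclideanSpace ℝ (Fin n)) :
    ⟪fderiv ℝ (fderiv ℝ h) y (𝐞 a) w, fderiv ℝ h y (𝐞 m)⟫ =
      ⟪fderiv ℝ h y (∑ l, w l • christoffelVec G a l y), fderiv ℝ h y (𝐞 m)⟫ := by
  conv_lhs => rw [← EuclideanSpace.sum_smul_single_one w]
  simp only [map_sum, map_smul, sum_inner, real_inner_smul_left,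
    hG.inner_christoffelVec hΩ hh hy hinj]

/-- The Gauss equation of `h`. -/
theorem inner_curvature (hinj : ∀ y ∈ Ω, Function.Injective (fderiv ℝ h y))
    {y : EuclideanSpace ℝ (Fin n)} (hy : y ∈ Ω) (a j k m : Fin n) :
    ⟪fderiv ℝ h y (∑ l, curvatureCoeff G l a j k y • (𝐞 l)), fderiv ℝ h y (𝐞 m)⟫ =
      ⟪secondFundamental h G j k y, fderiv ℝ (fderiv ℝ h) y (𝐞 a) (𝐞 m)⟫ -
        ⟪secondFundamental h G a k y, fderiv ℝ (fderiv ℝ h) y (𝐞 j) (𝐞 m)⟫ := by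
  have hhy := hh.contDiffAt (hΩ.mem_nhds hy)
  have hd := differentiableAt_fderiv hhy
  have hd2 := differentiableAt_fderiv (hhy.fderiv_right (m := ∞) (by simp))
  -- Differentiate in direction a the vanishing product of `secondFundamental` with a tangent
  -- vector. Exchanging a and j and subtracting removes the third derivative and leaves the
  -- curvature.
  have key : ∀ a j k, ⟪secondFundamental h G j k y, fderiv ℝ (fderiv ℝ h) y (𝐞 a) (𝐞 m)⟫ +
      ⟪fderiv ℝ (fderiv ℝ (fderiv ℝ h)) y (𝐞 a) (𝐞 j) (𝐞 k) -
        (fderiv ℝ (fderiv ℝ h) y (𝐞 a) (christoffelVec G j k y) +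
          fderiv ℝ h y (∑ l, partialDeriv a (christoffel G l j k) y • (𝐞 l))),
        fderiv ℝ h y (𝐞 m)⟫ = 0 := by
    intro a j k
    have hΓ := hG.hasFDerivAt_christoffelVec hΩ hh hy (hinj y hy) j k
    have h0 : (fun z => ⟪secondFundamental h G j k z, fderiv ℝ h z (𝐞 m)⟫) =ᶠ[𝓝 y] fun _ => 0 :=
      Filter.eventuallyEq_of_mem (hΩ.mem_nhds hy) fun z hz => by
        simp only [secondFundamental, inner_sub_left]
        rw [hG.inner_christoffelVec hΩ hh hz (hinj z hz), sub_self]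
    have h1 : HasFDerivAt (secondFundamental h G j k) _ y :=
      ((hd2.hasFDerivAt.clm_apply (hasFDerivAt_const (𝐞 j) y)).clm_apply
        (hasFDerivAt_const (𝐞 k) y)).sub (hd.hasFDerivAt.clm_apply hΓ)
    have h2 := (h1.inner ℝ (hd.hasFDerivAt.clm_apply (hasFDerivAt_const (𝐞 m) y))).fderiv
    rw [h0.fderiv_eq] at h2
    have h3 := congrArg (fun A : EuclideanSpace ℝ (Fin n) →L[ℝ] ℝ => A (𝐞 a)) h2
    simp [partialDeriv] at h3 ⊢
    rw [add_comm (fderiv ℝ (fderiv ℝ h) y (𝐞 a) (christoffelVec G j k y))]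
    exact h3.symm
  have h1 := key a j k
  have h2 := key j a k
  rw [fderiv_fderiv_comm (hhy.fderiv_right (m := ∞) (by simp)) (𝐞 j) (𝐞 a)] at h2
  rw [inner_sub_left, inner_add_left, hG.inner_fderiv_fderiv_vec hΩ hh hy (hinj y hy)] at h1 h2
  have hR : (∑ l, curvatureCoeff G l a j k y • (𝐞 l)) =
      (∑ l, partialDeriv a (christoffel G l j k) y • (𝐞 l)) -
        (∑ l, partialDeriv j (christoffel G l a k) y • (𝐞 l)) +
      ((∑ l, (christoffelVec G j k y) l • christoffelVec G a l y) -
        ∑ l, (christoffelVec G a k y) l • christoffelVec G j l y) := by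
    ext i
    simp [curvatureCoeff, christoffelVec_apply, Finset.sum_apply, Pi.single_apply]
  rw [hR]
  simp only [map_add, map_sub, inner_add_left, inner_sub_left]
  linarith

theorem inner_secondFundamental {y : EuclideanSpace ℝ (Fin n)} (hy : y ∈ Ω)
    (hinj : Function.Injective (fderiv ℝ h y)) (i j : Fin n) (u : EuclideanSpace ℝ (Fin n)) :
    ⟪secondFundamental h G i j y, fderiv ℝ h y u⟫ = 0 := by
  rw [← EuclideanSpace.sum_smul_single_one u]
  simp only [map_sum, map_smul, inner_sum, real_inner_smul_right]
  refine Finset.sum_eq_zero fun m _ => ?_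
  rw [secondFundamental, inner_sub_left, hG.inner_christoffelVec hΩ hh hy hinj, sub_self, mul_zero]

theorem inner_secondFundamental_fderiv {y : EuclideanSpace ℝ (Fin n)} (hy : y ∈ Ω)
    (hinj : Function.Injective (fderiv ℝ h y)) (i j k l : Fin n) :
    ⟪secondFundamental h G i j y, fderiv ℝ (fderiv ℝ h) y (𝐞 k) (𝐞 l)⟫ =
      ⟪secondFundamental h G i j y, secondFundamental h G k l y⟫ := by
  conv_rhs => rw [secondFundamental.eq_1 h G k l y]
  rw [inner_sub_right, hG.inner_secondFundamental hΩ hh hy hinj, sub_zero]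

theorem secondFundamental_comm {y : EuclideanSpace ℝ (Fin n)} (hy : y ∈ Ω) (i j : Fin n) :
    secondFundamental h G i j y = secondFundamental h G j i y := by
  have h1 := fderiv_fderiv_comm (hh.contDiffAt (hΩ.mem_nhds hy)) (𝐞 i) (𝐞 j)
  have h2 : christoffelVec G i j y = christoffelVec G j i y := by
    ext k
    rw [christoffelVec_apply, christoffelVec_apply, hG.christoffel_eq hΩ hh hy,
      hG.christoffel_eq hΩ hh hy, h1]
  rw [secondFundamental, secondFundamental, h1, h2]

/-- The trace of the Gauss equation: `(G y)⁻¹` recovers the coefficients of the curvature vector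
from its products with the frame, and normality replaces second derivatives by their normal parts.
-/
theorem ricciCoeff_eq (hinj : ∀ y ∈ Ω, Function.Injective (fderiv ℝ h y))
    {y : EuclideanSpace ℝ (Fin n)} (hy : y ∈ Ω) (j k : Fin n) :
    ricciCoeff G j k y = ∑ i, ∑ m, (G y)⁻¹ i m *
      (⟪secondFundamental h G j k y, secondFundamental h G i m y⟫ -
        ⟪secondFundamental h G i k y, secondFundamental h G m j y⟫) := by
  refine Finset.sum_congr rfl fun i _ => ?_
  have h1 := hG.apply_eq_of_inner hy (hinj y hy)
    (fun m => hG.inner_curvature hΩ hh hinj hy i j k m) i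
  have h2 : (∑ l, curvatureCoeff G l i j k y • (𝐞 l)) i = curvatureCoeff G i i j k y := by
    simp [Finset.sum_apply, Pi.single_apply]
  rw [← h2, h1]
  refine Finset.sum_congr rfl fun m _ => ?_
  rw [hG.inner_secondFundamental_fderiv hΩ hh hy (hinj y hy),
    hG.inner_secondFundamental_fderiv hΩ hh hy (hinj y hy),
    hG.secondFundamental_comm hΩ hh hy m j]

/-- The Ricci curvature is nonpositive in asymptotic directions. -/
theorem ricci_nonpos_of_asymptotic (hinj : ∀ y ∈ Ω, Function.Injective (fderiv ℝ h y))
    {y : EuclideanSpace ℝ (Fin n)} (hy : y ∈ Ω) (X w : EuclideanSpace ℝ (Fin n))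
    (hX : fderiv ℝ (fderiv ℝ h) y X X = fderiv ℝ h y w) :
    ∑ j, ∑ k, ricciCoeff G j k y * X j * X k ≤ 0 := by
  set N := fun i j => secondFundamental h G i j y with hN
  have hNX : ∑ j, ∑ k, (X j * X k) • N j k = 0 := by
    have h1 : ∑ j, ∑ k, (X j * X k) • N j k =
        fderiv ℝ h y (w - ∑ j, ∑ k, (X j * X k) • christoffelVec G j k y) := by
      have h2 : fderiv ℝ (fderiv ℝ h) y X X =
          fderiv ℝ (fderiv ℝ h) y (∑ j, X j • (𝐞 j)) (∑ j, X j • (𝐞 j)) := by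
        rw [EuclideanSpace.sum_smul_single_one]
      rw [map_sub, ← hX, h2]
      simp only [hN, secondFundamental, smul_sub, Finset.sum_sub_distrib, map_sum, map_smul,
        sum_apply, smul_apply, mul_smul, Finset.smul_sum]
      congr 1
      rw [Finset.sum_comm]
      refine Finset.sum_congr rfl fun j _ => Finset.sum_congr rfl fun k _ => ?_
      rw [smul_comm]
    -- The vector is tangential by `h1` and a combination of normal vectors, hence orthogonal to
    -- itself.
    rw [← inner_self_eq_zero (𝕜 := ℝ)]
    nth_rewrite 2 [h1]
    rw [sum_inner]
    refine Finset.sum_eq_zero fun j _ => ?_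
    rw [sum_inner]
    refine Finset.sum_eq_zero fun k _ => ?_
    rw [real_inner_smul_left, hG.inner_secondFundamental hΩ hh hy (hinj y hy), mul_zero]
  -- The first product contains α(X, X) = 0; the second is minus a trace of ⟨α(eᵢ, X), α(eₘ, X)⟩
  -- against the positive definite `(G y)⁻¹`.
  have h1 : ∑ j, ∑ k, ricciCoeff G j k y * X j * X k =
      ∑ i, ∑ m, ((G y)⁻¹ i m * ⟪∑ j, ∑ k, (X j * X k) • N j k, N i m⟫ -
        (G y)⁻¹ i m * ⟪∑ k, X k • N i k, ∑ k, X k • N m k⟫) := by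
    have hF := Finset.sum_comm (s := Finset.univ) (t := Finset.univ)
      (f := fun p q : Fin n × Fin n => (G y)⁻¹ q.1 q.2 *
        (⟪N p.1 p.2, N q.1 q.2⟫ - ⟪N q.1 p.2, N q.2 p.1⟫) * X p.1 * X p.2)
    simp only [Fintype.sum_prod_type] at hF
    simp only [hG.ricciCoeff_eq hΩ hh hinj hy, Finset.sum_mul]
    rw [hF]
    refine Finset.sum_congr rfl fun i _ => Finset.sum_congr rfl fun m _ => ?_
    simp only [sum_inner, inner_sum, real_inner_smul_left, real_inner_smul_right, Finset.mul_sum]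
    rw [← Finset.sum_sub_distrib]
    refine Finset.sum_congr rfl fun j _ => ?_
    rw [← Finset.sum_sub_distrib]
    refine Finset.sum_congr rfl fun k _ => ?_
    ring
  rw [h1, hNX]
  simp only [inner_zero_left, mul_zero, zero_sub, Finset.sum_neg_distrib, Left.neg_nonpos_iff]
  exact (hG.posDef hy (hinj y hy)).inv.posSemidef.sum_inner_nonneg fun i => ∑ k, X k • N i k

end IsInducedMetric

end Ricci

/-! ### From the manifold to charts and back -/

section Chart

variable {n : ℕ} {M : Type*} [TopologicalSpace M] [ChartedSpace (𝔼 n) M] [IsManifold (𝓡 n) ∞ M]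
  {g : SmoothMetric n M} {m m' : ℕ} {f : M → 𝔼 m} {f' : M → 𝔼 m'}

theorem mfderiv_extChartAt_symm_injective (x : M) {y : 𝔼 n} (hy : y ∈ (extChartAt (𝓡 n) x).target) :
    Function.Injective (mfderiv 𝓘(ℝ, 𝔼 n) (𝓡 n) (extChartAt (𝓡 n) x).symm y) := by
  have : IsManifold (𝓡 n) 1 M := IsManifold.of_le (n := ∞) (by simp)
  have h := isInvertible_mfderivWithin_extChartAt_symm (I := 𝓡 n) hy
  rw [ModelWithCorners.range_eq_univ, mfderivWithin_univ] at h
  exact h.injective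

theorem mfderiv_extChartAt_injective (x : M) {z : M} (hz : z ∈ (extChartAt (𝓡 n) x).source) :
    Function.Injective (mfderiv (𝓡 n) 𝓘(ℝ, 𝔼 n) (extChartAt (𝓡 n) x) z) := by
  have : IsManifold (𝓡 n) 1 M := IsManifold.of_le (n := ∞) (by simp)
  exact (isInvertible_mfderiv_extChartAt (I := 𝓡 n) hz).injective

theorem tangentCoords_surjective (x : M) : Function.Surjective (tangentCoords (n := n) x) := by
  have : IsManifold (𝓡 n) 1 M := IsManifold.of_le (n := ∞) (by simp)
  exact (isInvertible_mfderiv_extChartAt (I := 𝓡 n) (mem_extChartAt_source x)).surjective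

theorem mdifferentiableAt_extChartAt_symm (x : M) {y : 𝔼 n}
    (hy : y ∈ (extChartAt (𝓡 n) x).target) :
    MDifferentiableAt 𝓘(ℝ, 𝔼 n) (𝓡 n) (extChartAt (𝓡 n) x).symm y :=
  ((contMDiffOn_extChartAt_symm (I := 𝓡 n) (n := ∞) x).contMDiffAt
    ((isOpen_extChartAt_target x).mem_nhds hy)).mdifferentiableAt (by simp)

namespace IsIsometricImmersion

theorem contDiffOn_comp_symm (hf : IsIsometricImmersion g f) (x : M) :
    ContDiffOn ℝ ∞ (f ∘ (extChartAt (𝓡 n) x).symm) (extChartAt (𝓡 n) x).target := by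
  rw [← contMDiffOn_iff_contDiffOn]
  exact hf.smooth.comp_contMDiffOn (contMDiffOn_extChartAt_symm x)

theorem fderiv_comp_symm (hf : IsIsometricImmersion g f) (x : M) {y : 𝔼 n}
    (hy : y ∈ (extChartAt (𝓡 n) x).target) (u : 𝔼 n) :
    fderiv ℝ (f ∘ (extChartAt (𝓡 n) x).symm) y u =
      mfderiv (𝓡 n) 𝓘(ℝ, 𝔼 m) f ((extChartAt (𝓡 n) x).symm y)
        (mfderiv 𝓘(ℝ, 𝔼 n) (𝓡 n) (extChartAt (𝓡 n) x).symm y u) := by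
  rw [← mfderiv_eq_fderiv, mfderiv_comp y (hf.smooth.mdifferentiable (by simp) _)
    (mdifferentiableAt_extChartAt_symm x hy)]
  rfl

theorem inner_fderiv_comp_symm (hf : IsIsometricImmersion g f) (x : M) {y : 𝔼 n}
    (hy : y ∈ (extChartAt (𝓡 n) x).target) (u w : 𝔼 n) :
    ⟪fderiv ℝ (f ∘ (extChartAt (𝓡 n) x).symm) y u, fderiv ℝ (f ∘ (extChartAt (𝓡 n) x).symm) y w⟫ =
      g.inner ((extChartAt (𝓡 n) x).symm y)
        (mfderiv 𝓘(ℝ, 𝔼 n) (𝓡 n) (extChartAt (𝓡 n) x).symm y u)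
        (mfderiv 𝓘(ℝ, 𝔼 n) (𝓡 n) (extChartAt (𝓡 n) x).symm y w) := by
  rw [hf.fderiv_comp_symm x hy, hf.fderiv_comp_symm x hy]
  exact hf.isometric _ _ _

theorem isInducedMetric (hf : IsIsometricImmersion g f) (x : M) :
    IsInducedMetric (extChartAt (𝓡 n) x).target (f ∘ (extChartAt (𝓡 n) x).symm)
      (metricCoeff g x) := fun y hy i j => by
  rw [hf.inner_fderiv_comp_symm x hy]
  rfl

theorem fderiv_comp_symm_injective (hf : IsIsometricImmersion g f) (x : M) {y : 𝔼 n}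
    (hy : y ∈ (extChartAt (𝓡 n) x).target) :
    Function.Injective (fderiv ℝ (f ∘ (extChartAt (𝓡 n) x).symm) y) := by
  refine (injective_iff_map_eq_zero _).mpr fun u hu => ?_
  by_contra hu0
  have h1 := hf.inner_fderiv_comp_symm x hy u u
  rw [hu, inner_zero_left] at h1
  have h2 := g.pos ((extChartAt (𝓡 n) x).symm y)
    (mfderiv 𝓘(ℝ, 𝔼 n) (𝓡 n) (extChartAt (𝓡 n) x).symm y u)
    (fun h => hu0 (mfderiv_extChartAt_symm_injective x hy (h.trans (map_zero _).symm)))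
  exact h2.ne h1

/-- An isometric immersion of a manifold of positive Ricci curvature has no asymptotic
directions. -/
theorem not_asymptotic (hf : IsIsometricImmersion g f) (hRic : HasPositiveRicci g) (x : M)
    (X : 𝔼 n) (hX : X ≠ 0) (w : 𝔼 n) :
    fderiv ℝ (fderiv ℝ (f ∘ (extChartAt (𝓡 n) x).symm)) (extChartAt (𝓡 n) x x) X X ≠
      fderiv ℝ (f ∘ (extChartAt (𝓡 n) x).symm) (extChartAt (𝓡 n) x x) w := by
  intro h
  obtain ⟨v, hv⟩ := tangentCoords_surjective x X
  have hv0 : v ≠ 0 := by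
    rintro rfl
    exact hX (hv.symm.trans (map_zero (mfderiv (𝓡 n) 𝓘(ℝ, 𝔼 n) (extChartAt (𝓡 n) x) x)))
  have h1 := hRic x v hv0
  have h2 := (hf.isInducedMetric x).ricci_nonpos_of_asymptotic (isOpen_extChartAt_target x)
    (hf.contDiffOn_comp_symm x) (fun y hy => hf.fderiv_comp_symm_injective x hy)
    (mem_extChartAt_target x) X w h
  rw [ricciTensor, hv] at h1
  exact absurd h1 (not_lt.mpr h2)

end IsIsometricImmersion

/-- Absence of asymptotic directions is an open condition. -/
theorem eventually_not_asymptotic {E : Type*} [NormedAddCommGroup E] [NormedSpace ℝ E]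
    {Ω : Set (𝔼 n)} (hΩ : IsOpen Ω)
    {h : (𝔼 n) → E} (hh : ContDiffOn ℝ ∞ h Ω) (hinj : ∀ y ∈ Ω, Function.Injective (fderiv ℝ h y))
    {y₀ : 𝔼 n} (hy₀ : y₀ ∈ Ω)
    (h0 : ∀ X, X ≠ 0 → ∀ w, fderiv ℝ (fderiv ℝ h) y₀ X X ≠ fderiv ℝ h y₀ w) :
    ∀ᶠ y in 𝓝 y₀, ∀ X, X ≠ 0 → ∀ w, fderiv ℝ (fderiv ℝ h) y X X ≠ fderiv ℝ h y w := by
  have hh1 := hh.fderiv_of_isOpen (m := ∞) hΩ (by simp)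
  have hh2 := hh1.fderiv_of_isOpen (m := ∞) hΩ (by simp)
  -- X fails to be asymptotic exactly when (w, c) ↦ h_*w + c D²h(X, X) is injective, an open
  -- condition in (y, X).
  let T : (𝔼 n) × (𝔼 n) → (𝔼 n) × ℝ →L[ℝ] E := fun q =>
    (fderiv ℝ h q.1).comp (ContinuousLinearMap.fst ℝ (𝔼 n) ℝ) +
      (ContinuousLinearMap.snd ℝ (𝔼 n) ℝ).smulRight (fderiv ℝ (fderiv ℝ h) q.1 q.2 q.2)
  have hT : ∀ q z, T q z = fderiv ℝ h q.1 z.1 + z.2 • fderiv ℝ (fderiv ℝ h) q.1 q.2 q.2 :=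
    fun q z => rfl
  have hTiff : ∀ y ∈ Ω, ∀ X, Function.Injective (T (y, X)) ↔
      ∀ w, fderiv ℝ (fderiv ℝ h) y X X ≠ fderiv ℝ h y w := by
    intro y hy X
    constructor
    · intro hi w hw
      have h1 : T (y, X) (-w, 1) = T (y, X) 0 := by simp [hT, hw]
      simpa using congrArg Prod.snd (hi h1)
    · intro hX
      refine (injective_iff_map_eq_zero _).mpr fun z hz => ?_
      rw [hT] at hz
      have hc : z.2 = 0 := by
        by_contra hc
        refine hX (-(z.2⁻¹ • z.1)) ?_
        rw [map_neg, map_smul, eq_neg_of_add_eq_zero_left hz, smul_neg, neg_neg,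
          inv_smul_smul₀ hc]
      rw [hc, zero_smul, add_zero] at hz
      exact Prod.ext (hinj y hy (hz.trans (map_zero _).symm)) hc
  have hcont : ∀ X, ContinuousAt T (y₀, X) := by
    intro X
    have hf : ContinuousAt (fun q : (𝔼 n) × (𝔼 n) => q.1) (y₀, X) := continuousAt_fst
    have h1 : ContinuousAt (fun q : (𝔼 n) × (𝔼 n) => fderiv ℝ h q.1) (y₀, X) :=
      ContinuousAt.comp (f := fun q : (𝔼 n) × (𝔼 n) => q.1)
        (hh1.continuousOn.continuousAt (hΩ.mem_nhds hy₀)) hf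
    have h2 : ContinuousAt (fun q : (𝔼 n) × (𝔼 n) => fderiv ℝ (fderiv ℝ h) q.1) (y₀, X) :=
      ContinuousAt.comp (f := fun q : (𝔼 n) × (𝔼 n) => q.1)
        (hh2.continuousOn.continuousAt (hΩ.mem_nhds hy₀)) hf
    have h4 : Continuous fun e : E => (ContinuousLinearMap.snd ℝ (𝔼 n) ℝ).smulRight e :=
      (ContinuousLinearMap.smulRightL ℝ ((𝔼 n) × ℝ) E
        (ContinuousLinearMap.snd ℝ (𝔼 n) ℝ)).continuous
    exact (h1.clm_comp continuousAt_const).add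
      (h4.continuousAt.comp ((h2.clm_apply continuousAt_snd).clm_apply continuousAt_snd))
  -- Compactness of the unit sphere gives a neighbourhood of y₀ that works for all unit X;
  -- homogeneity covers the rest.
  have hsph : ∀ᶠ y in 𝓝 y₀, ∀ X ∈ Metric.sphere (0 : 𝔼 n) 1, Function.Injective (T (y, X)) := by
    refine (isCompact_sphere (0 : 𝔼 n) 1).eventually_forall_of_forall_eventually fun X hX => ?_
    refine (hcont X).eventually (ContinuousLinearMap.isOpen_injective.mem_nhds ?_)
    exact (hTiff y₀ hy₀ X).mpr (h0 X (ne_zero_of_mem_unit_sphere ⟨X, hX⟩))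
  filter_upwards [hsph, hΩ.mem_nhds hy₀] with y hy hyΩ X hX w hw
  have hX' : ‖X‖ ≠ 0 := norm_ne_zero_iff.mpr hX
  -- The second derivative is quadratic in X, so w is rescaled twice.
  have h1 := (hTiff y hyΩ _).mp (hy (‖X‖⁻¹ • X) (by
    rw [mem_sphere_zero_iff_norm, norm_smul, norm_inv, norm_norm, inv_mul_cancel₀ hX']))
    (‖X‖⁻¹ • ‖X‖⁻¹ • w)
  simp only [map_smul, smul_apply, hw] at h1
  exact h1 rfl

/-- The differential of a map into Euclidean space, read in the preferred chart at the point. -/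
noncomputable def euclideanDifferential (f : M → 𝔼 m) (x : M) : (𝔼 n) →L[ℝ] 𝔼 m :=
  mfderiv (𝓡 n) 𝓘(ℝ, 𝔼 m) f x

theorem euclideanDifferential_congr {f v : M → 𝔼 m} {x : M} (h : f =ᶠ[𝓝 x] v) :
    euclideanDifferential (n := n) f x = euclideanDifferential v x := h.mfderiv_eq

/-- The differential at `(x, t)` of the ruled map `(x, t) ↦ f x + t v x`. -/
noncomputable def ruledDifferential (f v : M → 𝔼 m) (x : M) (t : ℝ) : (𝔼 n) × ℝ →L[ℝ] 𝔼 m :=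
  ruledMap (euclideanDifferential f x) (euclideanDifferential v x) (v x) t

/-- The pair `v`, `v'` spans at `x` an isometric ruled extension of `f`, `f'` that is immersive off
the zero section. -/
structure IsRuledExtensionAt (n : ℕ) {M : Type*} [TopologicalSpace M] [ChartedSpace (𝔼 n) M]
    {m m' : ℕ} (f : M → 𝔼 m) (f' : M → 𝔼 m') (v : M → 𝔼 m) (v' : M → 𝔼 m')
    (x : M) : Prop where
  smooth_left : ContMDiffAt (𝓡 n) 𝓘(ℝ, 𝔼 m) ∞ v x
  smooth_right : ContMDiffAt (𝓡 n) 𝓘(ℝ, 𝔼 m') ∞ v' x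
  isometric : ∀ t : ℝ, |t| < 2 → ∀ z z' : (𝔼 n) × ℝ,
    ⟪ruledDifferential f v x t z, ruledDifferential f v x t z'⟫ =
      ⟪ruledDifferential f' v' x t z, ruledDifferential f' v' x t z'⟫
  injective : ∀ t : ℝ, |t| < 2 → t ≠ 0 → Function.Injective (ruledDifferential (n := n) f v x t)

theorem IsRuledExtensionAt.congr {f : M → 𝔼 m} {f' : M → 𝔼 m'} {v w : M → 𝔼 m} {v' w' : M → 𝔼 m'}
    {x : M} (h : IsRuledExtensionAt n f f' v v' x) (hv : w =ᶠ[𝓝 x] v) (hv' : w' =ᶠ[𝓝 x] v') :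
    IsRuledExtensionAt n f f' w w' x := by
  have h1 : ∀ t, ruledDifferential (n := n) f w x t = ruledDifferential f v x t := fun t => by
    rw [ruledDifferential, ruledDifferential, euclideanDifferential_congr hv, hv.eq_of_nhds]
  have h2 : ∀ t, ruledDifferential (n := n) f' w' x t = ruledDifferential f' v' x t := fun t => by
    rw [ruledDifferential, ruledDifferential, euclideanDifferential_congr hv', hv'.eq_of_nhds]
  refine ⟨h.smooth_left.congr_of_eventuallyEq hv, h.smooth_right.congr_of_eventuallyEq hv', ?_, ?_⟩
  · intro t ht z z'
    rw [h1, h2]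
    exact h.isometric t ht z z'
  · intro t ht ht0
    rw [h1]
    exact h.injective t ht ht0

/-- The ruled differential of a map given in a chart. -/
theorem ruledDifferential_eq_of_chart {f : M → 𝔼 m} (hf : ContMDiff (𝓡 n) 𝓘(ℝ, 𝔼 m) ∞ f) (x₁ : M)
    {v : (𝔼 n) → 𝔼 m} {x : M} (hx : x ∈ (extChartAt (𝓡 n) x₁).source)
    (hv : DifferentiableAt ℝ v (extChartAt (𝓡 n) x₁ x)) (t : ℝ) (z : (𝔼 n) × ℝ) :
    ruledDifferential f (v ∘ extChartAt (𝓡 n) x₁) x t z =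
      ruledMap (fderiv ℝ (f ∘ (extChartAt (𝓡 n) x₁).symm) (extChartAt (𝓡 n) x₁ x))
        (fderiv ℝ v (extChartAt (𝓡 n) x₁ x)) (v (extChartAt (𝓡 n) x₁ x)) t
        (euclideanDifferential (extChartAt (𝓡 n) x₁) x z.1, z.2) := by
  have hφ : MDifferentiableAt (𝓡 n) 𝓘(ℝ, 𝔼 n) (extChartAt (𝓡 n) x₁) x :=
    mdifferentiableAt_extChartAt (by simpa using hx)
  have hmem := (extChartAt (𝓡 n) x₁).map_source hx
  have hcomp : ∀ {k : (𝔼 n) → 𝔼 m}, DifferentiableAt ℝ k (extChartAt (𝓡 n) x₁ x) → ∀ ξ : 𝔼 n,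
      euclideanDifferential (k ∘ extChartAt (𝓡 n) x₁) x ξ =
        fderiv ℝ k (extChartAt (𝓡 n) x₁ x)
          (euclideanDifferential (extChartAt (𝓡 n) x₁) x ξ) := by
    intro k hk ξ
    rw [euclideanDifferential, mfderiv_comp x hk.mdifferentiableAt hφ, mfderiv_eq_fderiv]
    rfl
  have hfd : DifferentiableAt ℝ (f ∘ (extChartAt (𝓡 n) x₁).symm) (extChartAt (𝓡 n) x₁ x) :=
    ((contMDiffOn_iff_contDiffOn.mp (hf.comp_contMDiffOn
      (contMDiffOn_extChartAt_symm x₁))).contDiffAt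
        ((isOpen_extChartAt_target x₁).mem_nhds hmem)).differentiableAt (by simp)
  have hfe : f =ᶠ[𝓝 x] (f ∘ (extChartAt (𝓡 n) x₁).symm) ∘ extChartAt (𝓡 n) x₁ := by
    filter_upwards [(isOpen_extChartAt_source x₁).mem_nhds hx] with x' hx'
    simp only [Function.comp_apply, (extChartAt (𝓡 n) x₁).left_inv hx']
  rw [ruledDifferential, ruledMap_apply, ruledMap_apply, hcomp hv,
    euclideanDifferential_congr hfe, hcomp hfd]
  rfl

/-- Locally, on a nonempty open subset, two isometric immersions of a manifold of positive Ricci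
curvature have ruled isometric extensions. -/
theorem exists_isRuledExtensionAt (hf : IsIsometricImmersion g f) (hf' : IsIsometricImmersion g f')
    (hRic : HasPositiveRicci g) (hdim : m + m' < 3 * n) (O : Set M) (hO : IsOpen O)
    (hne : O.Nonempty) : ∃ O' ⊆ O, IsOpen O' ∧ O'.Nonempty ∧ ∃ (v : M → 𝔼 m) (v' : M → 𝔼 m'),
      ∀ x ∈ O', IsRuledExtensionAt n f f' v v' x := by
  obtain ⟨x₁, hx₁⟩ := hne
  set φ := extChartAt (𝓡 n) x₁ with hφ
  have hopen := isOpen_extChartAt_target (I := 𝓡 n) x₁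
  have hinj : ∀ y ∈ φ.target, Function.Injective (fderiv ℝ (f ∘ φ.symm) y) := fun y hy =>
    hf.fderiv_comp_symm_injective x₁ hy
  -- `ricciTensor` at a point uses the chart preferred there, so in a fixed chart asymptotic
  -- directions are excluded only at its centre; openness spreads this to a neighbourhood.
  have hev := eventually_not_asymptotic hopen (hf.contDiffOn_comp_symm x₁) hinj
    (mem_extChartAt_target x₁) (hf.not_asymptotic hRic x₁)
  have hO1 : IsOpen (φ.target ∩ φ.symm ⁻¹' O) :=
    (continuousOn_extChartAt_symm x₁).isOpen_inter_preimage hopen hO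
  obtain ⟨Ω, hΩ, hΩo, hΩ1⟩ := eventually_nhds_iff.mp
    (hev.and (hO1.mem_nhds ⟨mem_extChartAt_target x₁, by simpa [hφ] using hx₁⟩))
  obtain ⟨Ω', hsub, hΩ'o, ⟨y, hy⟩, v, v', hv, hv', hext⟩ := exists_local_ruled_extension
    (h := f ∘ φ.symm) (k := f' ∘ φ.symm) hΩo ⟨_, hΩ1⟩
    ((hf.contDiffOn_comp_symm x₁).mono fun y hy => (hΩ y hy).2.1)
    ((hf'.contDiffOn_comp_symm x₁).mono fun y hy => (hΩ y hy).2.1)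
    (fun y hy => hinj y (hΩ y hy).2.1)
    (fun y hy u w => by
      rw [hf.inner_fderiv_comp_symm x₁ (hΩ y hy).2.1, hf'.inner_fderiv_comp_symm x₁ (hΩ y hy).2.1])
    (fun y hy => (hΩ y hy).1) (by simpa using hdim)
  refine ⟨φ.source ∩ φ ⁻¹' Ω', fun x hx => ?_,
    (continuousOn_extChartAt x₁).isOpen_inter_preimage (isOpen_extChartAt_source x₁) hΩ'o,
    ⟨φ.symm y, φ.map_target (hΩ y (hsub hy)).2.1, ?_⟩, v ∘ φ, v' ∘ φ, fun x hx => ?_⟩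
  · have := (hΩ _ (hsub hx.2)).2.2
    rwa [Set.mem_preimage, φ.left_inv hx.1] at this
  · rw [Set.mem_preimage, φ.right_inv (hΩ y (hsub hy)).2.1]
    exact hy
  · have hvx := hv.contDiffAt (hΩ'o.mem_nhds hx.2)
    have hvx' := hv'.contDiffAt (hΩ'o.mem_nhds hx.2)
    have hφx : ContMDiffAt (𝓡 n) 𝓘(ℝ, 𝔼 n) ∞ φ x :=
      contMDiffAt_extChartAt' (by simpa [hφ] using hx.1)
    have h1 := ruledDifferential_eq_of_chart hf.smooth x₁ hx.1 (hvx.differentiableAt (by simp))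
    have h2 := ruledDifferential_eq_of_chart hf'.smooth x₁ hx.1 (hvx'.differentiableAt (by simp))
    refine ⟨hvx.contMDiffAt.comp x hφx, hvx'.contMDiffAt.comp x hφx, ?_, ?_⟩
    · intro t ht z z'
      rw [h1, h1, h2, h2]
      exact (hext _ hx.2 t ht).1 _ _
    · intro t ht ht0 z z' hz
      rw [h1, h1] at hz
      have h3 := (hext _ hx.2 t ht).2 ht0 hz
      rw [Prod.mk.injEq] at h3
      exact Prod.ext (mfderiv_extChartAt_injective x₁ hx.1 h3.1) h3.2

end Chart

/-! ### From local data to an open dense set -/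

/-- Local data that exist on some nonempty open part of every nonempty open set, and depend only on
germs, exist on an open dense set. -/
theorem exists_isOpen_dense_of_local {M X : Type*} [TopologicalSpace M] [Nonempty X]
    (P : (M → X) → M → Prop) (hcongr : ∀ v w x, w =ᶠ[𝓝 x] v → P v x → P w x)
    (hloc : ∀ O : Set M, IsOpen O → O.Nonempty →
      ∃ O' ⊆ O, IsOpen O' ∧ O'.Nonempty ∧ ∃ v, ∀ x ∈ O', P v x) :
    ∃ U : Set M, IsOpen U ∧ Dense U ∧ ∃ v, ∀ x ∈ U, P v x := by
  -- Pairwise disjointness lets the choices on different members be combined with no compatibility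
  -- condition.
  let 𝒢 : Set (Set (Set M)) :=
    {S | (∀ O ∈ S, IsOpen O ∧ ∃ v, ∀ x ∈ O, P v x) ∧ S.PairwiseDisjoint id}
  obtain ⟨S, hS⟩ : ∃ S, Maximal (· ∈ 𝒢) S := by
    refine zorn_subset 𝒢 fun c hc hchain => ⟨⋃₀ c, ⟨?_, ?_⟩, fun s hs => Set.subset_sUnion_of_mem hs⟩
    · rintro O ⟨s, hs, hO⟩
      exact (hc hs).1 O hO
    · exact (Set.pairwiseDisjoint_sUnion hchain.directedOn).mpr fun s hs => (hc hs).2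
  have hdisj : ∀ O ∈ S, ∀ O' ∈ S, ∀ x, x ∈ O → x ∈ O' → O = O' := by
    intro O hO O' hO' x hx hx'
    by_contra hne
    exact Set.disjoint_left.mp (hS.1.2 hO hO' hne) hx hx'
  choose! v hv using fun O (hO : O ∈ S) => (hS.1.1 O hO).2
  have hmem : ∀ x, ∃ O, x ∈ ⋃₀ S → O ∈ S ∧ x ∈ O := fun x => by
    by_cases hx : x ∈ ⋃₀ S
    · obtain ⟨O, hO, hxO⟩ := hx
      exact ⟨O, fun _ => ⟨hO, hxO⟩⟩
    · exact ⟨∅, fun h => absurd h hx⟩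
  choose piece hpiece using hmem
  refine ⟨⋃₀ S, isOpen_sUnion fun O hO => (hS.1.1 O hO).1, ?_, fun x => v (piece x) x, ?_⟩
  · by_contra hd
    rw [dense_iff_closure_eq, ← Ne, Set.ne_univ_iff_exists_notMem] at hd
    obtain ⟨x, hx⟩ := hd
    -- A piece found off the closure could be added to S, so by maximality it already belongs to S,
    -- although it is nonempty and disjoint from the union.
    obtain ⟨O', hsub, hO', ⟨y, hy⟩, w, hw⟩ := hloc (closure (⋃₀ S))ᶜ isClosed_closure.isOpen_compl ⟨x, hx⟩
    have hins : insert O' S ∈ 𝒢 := by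
      refine ⟨?_, hS.1.2.insert fun O hO _ => ?_⟩
      · rintro O (rfl | hO)
        · exact ⟨hO', w, hw⟩
        · exact hS.1.1 O hO
      · exact Set.disjoint_left.mpr fun z hz hz' =>
          hsub hz (subset_closure ⟨O, hO, hz'⟩)
    have hO'S : O' ∈ S := hS.2 hins (Set.subset_insert _ _) (Set.mem_insert _ _)
    exact hsub hy (subset_closure ⟨O', hO'S, hy⟩)
  · rintro x ⟨O, hO, hx⟩
    refine hcongr (v O) _ x ?_ (hv O hO x hx)
    filter_upwards [(hS.1.1 O hO).1.mem_nhds hx] with z hz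
    have h1 := hpiece z ⟨O, hO, hz⟩
    rw [hdisj _ h1.1 O hO z h1.2 hz]

/-! ### The extension on U × ℝ -/

section Product

variable {n : ℕ} {M : Type*} [TopologicalSpace M] [ChartedSpace (𝔼 n) M] [IsManifold (𝓡 n) ∞ M]
  {m m' : ℕ}

/-- The preferred chart of U is the restriction of the one of M, so the inclusion is the identity in
coordinates, and differentials on U and on M are the same linear map. -/
theorem hasMFDerivAt_opens_val (U : TopologicalSpace.Opens M) (x : U) :
    HasMFDerivAt (𝓡 n) (𝓡 n) (Subtype.val : U → M) x (ContinuousLinearMap.id ℝ (𝔼 n)) := by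
  refine ⟨continuous_subtype_val.continuousAt, ?_⟩
  refine (hasFDerivWithinAt_id _ _).congr_of_eventuallyEq ?_ ?_
  · refine Filter.eventuallyEq_of_mem
      (nhdsWithin_le_nhds ((isOpen_extChartAt_target x).mem_nhds (mem_extChartAt_target x))) ?_
    intro y hy
    exact (extChartAt (𝓡 n) x).right_inv hy
  · exact (extChartAt (𝓡 n) x).right_inv (mem_extChartAt_target x)

theorem hasMFDerivAt_restrict {f : M → 𝔼 m} (U : TopologicalSpace.Opens M) (x : U)
    (hf : MDifferentiableAt (𝓡 n) 𝓘(ℝ, 𝔼 m) f x) :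
    HasMFDerivAt (𝓡 n) 𝓘(ℝ, 𝔼 m) (fun y : U => f y) x (euclideanDifferential (n := n) f x) :=
  hf.hasMFDerivAt.comp x (hasMFDerivAt_opens_val U x)

/-- The zero section is a smooth embedding. -/
theorem isSmoothEmbedding_zero_section {P : Type*} [TopologicalSpace P] [ChartedSpace (𝔼 n) P]
    [IsManifold (𝓡 n) ∞ P] :
    Manifold.IsSmoothEmbedding (𝓡 n) ((𝓡 n).prod 𝓘(ℝ, ℝ)) ∞ (fun x : P => (x, (0 : ℝ))) := by
  refine ⟨⟨ℝ, inferInstance, inferInstance, fun x => ?_⟩, isEmbedding_prodMkLeft 0⟩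
  refine Manifold.IsImmersionAtOfComplement.mk_of_continuousAt (by fun_prop)
    (ContinuousLinearEquiv.refl ℝ _) (chartAt (𝔼 n) x)
    (chartAt (ModelProd (𝔼 n) ℝ) (x, (0 : ℝ))) (mem_chart_source _ x) (mem_chart_source _ _)
    (IsManifold.chart_mem_maximalAtlas x) (IsManifold.chart_mem_maximalAtlas _) ?_
  intro y hy
  simp at hy
  simp [hy, chartAt_self_eq]

/-- The ruled map `(x, s) ↦ f x + arctan s • v x`. -/
noncomputable def arctanRuled {P : Type*} (f v : P → 𝔼 m) (q : P × ℝ) : 𝔼 m :=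
  f q.1 + Real.arctan q.2 • v q.1

theorem hasMFDerivAt_arctanRuled {P : Type*} [TopologicalSpace P] [ChartedSpace (𝔼 n) P]
    {f v : P → 𝔼 m} {x : P} {A B : (𝔼 n) →L[ℝ] 𝔼 m}
    (hf : HasMFDerivAt (𝓡 n) 𝓘(ℝ, 𝔼 m) f x A) (hv : HasMFDerivAt (𝓡 n) 𝓘(ℝ, 𝔼 m) v x B) (s : ℝ) :
    HasMFDerivAt ((𝓡 n).prod 𝓘(ℝ, ℝ)) 𝓘(ℝ, 𝔼 m) (arctanRuled f v) (x, s)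
      ((ruledMap A B (v x) (Real.arctan s)).comp
        ((ContinuousLinearMap.fst ℝ (𝔼 n) ℝ).prod
          ((1 / (1 + s ^ 2)) • ContinuousLinearMap.snd ℝ (𝔼 n) ℝ))) := by
  have hf1 : HasFDerivAt (f ∘ (extChartAt (𝓡 n) x).symm) A (extChartAt (𝓡 n) x x) :=
    hasFDerivWithinAt_univ.mp (by
      have := hf.2
      rw [ModelWithCorners.range_eq_univ] at this
      exact this)
  have hv1 : HasFDerivAt (v ∘ (extChartAt (𝓡 n) x).symm) B (extChartAt (𝓡 n) x x) :=
    hasFDerivWithinAt_univ.mp (by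
      have := hv.2
      rw [ModelWithCorners.range_eq_univ] at this
      exact this)
  have hv0 : (v ∘ (extChartAt (𝓡 n) x).symm) (extChartAt (𝓡 n) x x) = v x :=
    congrArg v ((extChartAt (𝓡 n) x).left_inv (mem_extChartAt_source x))
  have h1 : HasFDerivAt (fun z : (𝔼 n) × ℝ => z.1) (ContinuousLinearMap.fst ℝ (𝔼 n) ℝ)
      (extChartAt (𝓡 n) x x, s) := hasFDerivAt_fst
  have h2 : HasFDerivAt (fun z : (𝔼 n) × ℝ => z.2) (ContinuousLinearMap.snd ℝ (𝔼 n) ℝ)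
      (extChartAt (𝓡 n) x x, s) := hasFDerivAt_snd
  have h3 := ((hf1.comp (extChartAt (𝓡 n) x x, s) h1).add
    (h2.arctan.smul (hv1.comp (extChartAt (𝓡 n) x x, s) h1))).hasFDerivWithinAt (s := Set.univ)
  constructor
  · exact (hf.continuousAt.comp (x := (x, s)) continuousAt_fst).add
      ((Real.continuous_arctan.continuousAt.comp (x := (x, s)) continuousAt_snd).smul
        (hv.continuousAt.comp (x := (x, s)) continuousAt_fst))
  · rw [ModelWithCorners.range_eq_univ]
    rw [Function.comp_apply, hv0] at h3
    exact h3

/-- Transports a differential along the equality between the model of a product space and the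
product of the models. -/
theorem HasMFDerivAt.of_model_eq {E H P : Type*} [NormedAddCommGroup E] [NormedSpace ℝ E]
    [TopologicalSpace H] [TopologicalSpace P] [ChartedSpace H P] {I J : ModelWithCorners ℝ E H}
    (hIJ : I = J) {F : P → 𝔼 m} {q : P} {L : E →L[ℝ] 𝔼 m} (h : HasMFDerivAt J 𝓘(ℝ, 𝔼 m) F q L) :
    HasMFDerivAt I 𝓘(ℝ, 𝔼 m) F q L := by
  subst hIJ
  exact h

section Forms

variable {E P : Type*} [NormedAddCommGroup E] [NormedSpace ℝ E] [TopologicalSpace P]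
  [ChartedSpace E P] {F : P → 𝔼 m} {q : P} {L : E →L[ℝ] 𝔼 m}

theorem HasMFDerivAt.inducedForm_eq (h : HasMFDerivAt 𝓘(ℝ, E) 𝓘(ℝ, 𝔼 m) F q L) (z z' : E) :
    inducedForm E F q z z' = ⟪L z, L z'⟫ := by
  have e : (mfderiv 𝓘(ℝ, E) 𝓘(ℝ, 𝔼 m) F q : E →L[ℝ] 𝔼 m) = L := h.mfderiv
  subst e
  rfl

theorem HasMFDerivAt.immersiveAt_iff (h : HasMFDerivAt 𝓘(ℝ, E) 𝓘(ℝ, 𝔼 m) F q L) :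
    ImmersiveAt E F q ↔ Function.Injective L := by
  have e : (mfderiv 𝓘(ℝ, E) 𝓘(ℝ, 𝔼 m) F q : E →L[ℝ] 𝔼 m) = L := h.mfderiv
  subst e
  rfl

end Forms

/-- The fibre parameter is `arctan s`: it is a smooth function on all of ℝ with nowhere vanishing
derivative, stays within |t| < 2, and is zero only at s = 0. So N is the full product U × ℝ. -/
theorem singularlyExtends_of_isRuledExtensionAt [T2Space M] [SecondCountableTopology M]
    {f : M → 𝔼 m} {f' : M → 𝔼 m'} {v : M → 𝔼 m} {v' : M → 𝔼 m'}
    (hf : ContMDiff (𝓡 n) 𝓘(ℝ, 𝔼 m) ∞ f) (hf' : ContMDiff (𝓡 n) 𝓘(ℝ, 𝔼 m') ∞ f')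
    (U : TopologicalSpace.Opens M) (h : ∀ x ∈ U, IsRuledExtensionAt n f f' v v' x) :
    SingularlyExtendsIsometrically n (fun x : U => f x) (fun x : U => f' x) := by
  have hmodel : 𝓘(ℝ, (𝔼 n) × ℝ) = (𝓡 n).prod 𝓘(ℝ, ℝ) := modelWithCornersSelf_prod
  let cN : ChartedSpace ((𝔼 n) × ℝ) (U × ℝ) := prodChartedSpace (𝔼 n) U ℝ ℝ
  set F := arctanRuled (fun x : U => f x) (fun x : U => v x) with hF
  set F' := arctanRuled (fun x : U => f' x) (fun x : U => v' x) with hF'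
  have hvU : ContMDiff (𝓡 n) 𝓘(ℝ, 𝔼 m) ∞ (fun x : U => v x) := fun x =>
    (h x x.2).smooth_left.comp x contMDiff_subtype_val.contMDiffAt
  have hvU' : ContMDiff (𝓡 n) 𝓘(ℝ, 𝔼 m') ∞ (fun x : U => v' x) := fun x =>
    (h x x.2).smooth_right.comp x contMDiff_subtype_val.contMDiffAt
  let τ : ℝ → (𝔼 n) × ℝ →L[ℝ] (𝔼 n) × ℝ := fun s => (ContinuousLinearMap.fst ℝ (𝔼 n) ℝ).prod
    ((1 / (1 + s ^ 2)) • ContinuousLinearMap.snd ℝ (𝔼 n) ℝ)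
  have hτ : ∀ s, Function.Injective (τ s) := by
    intro s z z' hz
    have h1 : (z.1, (1 / (1 + s ^ 2)) * z.2) = (z'.1, (1 / (1 + s ^ 2)) * z'.2) := hz
    rw [Prod.mk.injEq] at h1
    have h2 : (1 / (1 + s ^ 2)) ≠ 0 := by positivity
    exact Prod.ext h1.1 (mul_left_cancel₀ h2 h1.2)
  have hd : ∀ (x : U) (s : ℝ), HasMFDerivAt 𝓘(ℝ, (𝔼 n) × ℝ) 𝓘(ℝ, 𝔼 m) F (x, s)
      ((ruledDifferential f v (x : M) (Real.arctan s)).comp (τ s)) := fun x s =>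
    HasMFDerivAt.of_model_eq hmodel (hasMFDerivAt_arctanRuled
      (hasMFDerivAt_restrict U x (hf.mdifferentiable (by simp) _))
      (hasMFDerivAt_restrict U x ((h x x.2).smooth_left.mdifferentiableAt (by simp))) s)
  have hd' : ∀ (x : U) (s : ℝ), HasMFDerivAt 𝓘(ℝ, (𝔼 n) × ℝ) 𝓘(ℝ, 𝔼 m') F' (x, s)
      ((ruledDifferential f' v' (x : M) (Real.arctan s)).comp (τ s)) := fun x s =>
    HasMFDerivAt.of_model_eq hmodel (hasMFDerivAt_arctanRuled
      (hasMFDerivAt_restrict U x (hf'.mdifferentiable (by simp) _))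
      (hasMFDerivAt_restrict U x ((h x x.2).smooth_right.mdifferentiableAt (by simp))) s)
  have harc : ∀ s, |Real.arctan s| < 2 := by
    intro s
    have h1 := Real.arctan_lt_pi_div_two s
    have h2 := Real.neg_pi_div_two_lt_arctan s
    have h3 := Real.pi_le_four
    rw [abs_lt]
    constructor <;> linarith
  have hsmooth : ∀ {k : ℕ} {a b : U → 𝔼 k}, ContMDiff (𝓡 n) 𝓘(ℝ, 𝔼 k) ∞ a →
      ContMDiff (𝓡 n) 𝓘(ℝ, 𝔼 k) ∞ b →
      ContMDiff 𝓘(ℝ, (𝔼 n) × ℝ) 𝓘(ℝ, 𝔼 k) ∞ (arctanRuled a b) := by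
    intro k a b ha hb
    rw [hmodel]
    exact (ha.comp contMDiff_fst).add ((Real.contDiff_arctan.contMDiff.comp contMDiff_snd).smul
      (hb.comp contMDiff_fst))
  have hiso : ∀ (q : U × ℝ) (z z' : (𝔼 n) × ℝ),
      inducedForm ((𝔼 n) × ℝ) F q z z' = inducedForm ((𝔼 n) × ℝ) F' q z z' := by
    rintro ⟨x, s⟩ z z'
    rw [(hd x s).inducedForm_eq, (hd' x s).inducedForm_eq]
    exact (h x x.2).isometric _ (harc s) _ _
  refine ⟨1, (𝔼 n) × ℝ, inferInstance, inferInstance, U × ℝ, inferInstance, cN,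
    fun x => (x, 0), F, F', one_pos, by simp, ?_, inferInstance, inferInstance,
    ?_, ?_, ?_, hiso, ?_, ?_, ?_⟩
  · rw [hmodel]
    exact (inferInstance : IsManifold ((𝓡 n).prod 𝓘(ℝ, ℝ)) ∞ (U × ℝ))
  · rw [hmodel]
    exact isSmoothEmbedding_zero_section
  · exact hsmooth (hf.comp contMDiff_subtype_val) hvU
  · exact hsmooth (hf'.comp contMDiff_subtype_val) hvU'
  · funext x
    simp [hF, arctanRuled]
  · funext x
    simp [hF', arctanRuled]
  · rintro ⟨x, s⟩ hq
    by_contra hs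
    have hs0 : Real.arctan s ≠ 0 := fun h0 => hs ⟨x, by
      rw [Real.arctan_eq_zero_iff] at h0
      rw [h0]⟩
    have himm := ((h x x.2).injective _ (harc s) hs0).comp (hτ s)
    refine hq.elim (fun h1 => h1 ((hd x s).immersiveAt_iff.mpr himm)) fun h1 =>
      h1 ((hd' x s).immersiveAt_iff.mpr ?_)
    -- Immersivity of the second map is inherited: both induce the same form, which is definite
    -- where the first is an immersion.
    refine (injective_iff_map_eq_zero _).mpr fun z hz => ?_
    have h2 := hiso (x, s) z z
    rw [(hd x s).inducedForm_eq, (hd' x s).inducedForm_eq, hz, inner_zero_left,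
      inner_self_eq_zero] at h2
    exact himm (h2.trans (map_zero ((ruledDifferential f v (x : M) (Real.arctan s)).comp
      (τ s))).symm)

end Product

theorem mainTheorem5 {n p : ℕ} {M : Type*} [TopologicalSpace M] [T2Space M]
    [SecondCountableTopology M] [ChartedSpace (EuclideanSpace ℝ (Fin n)) M]
    [IsManifold (𝓡 n) ∞ M] (g : SmoothMetric n M) (hRic : HasPositiveRicci g)
    (f : M → EuclideanSpace ℝ (Fin (n + p))) (hf : IsIsometricImmersion g f) :
    ∀ q : ℕ, (q : ℤ) < (n : ℤ) - (p : ℤ) → SingularlyGenuinelyRigid g f q := by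
  intro q hq f' hf'
  obtain ⟨U, hU, hdense, v, hv⟩ := exists_isOpen_dense_of_local
    (fun (v : M → (EuclideanSpace ℝ (Fin (n + p))) × EuclideanSpace ℝ (Fin (n + q))) x =>
      IsRuledExtensionAt n f f' (fun y => (v y).1) (fun y => (v y).2) x)
    (fun v w x hwv h => h.congr (hwv.fun_comp Prod.fst) (hwv.fun_comp Prod.snd))
    -- The dimension condition (n + p) + (n + q) < 3n is exactly q < n - p.
    (fun O hO hne => by
      obtain ⟨O', hsub, hO', hne', v, v', h⟩ :=
        exists_isRuledExtensionAt hf hf' hRic (by omega) O hO hne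
      exact ⟨O', hsub, hO', hne', fun y => (v y, v' y), h⟩)
  exact ⟨⟨U, hU⟩, hdense, singularlyExtends_of_isRuledExtensionAt hf.smooth hf'.smooth ⟨U, hU⟩ hv⟩
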